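/- Let $\mathbb S^1=\mathbb R/\mathbb Z$ and let $U:\mathbb R\to\mathbb R$ be smooth and skew periodic, $U(x+1)=U(x)-\bar b$ for a constant $\bar b$. Assume that the critical points of $U$ are exactly the points $x_i$ and $x_{i+\frac12}$, $i\in\mathbb Z$, where for some $k\ge 1$ $$x_{i-\frac12}<x_i<x_{i+\frac12},\qquad x_{i+k}=x_i+1,\qquad x_{i+k+\frac12}=x_{i+\frac12}+1\qquad (i\in\mathbb Z),$$ each $x_i$ is a local minimum of $U$ and each $x_{i+\frac12}$ is a local maximum of $U$. Let $L(s,x)=\frac14\,(s+U'(x))^2$; it is $1$-periodic in $x$ and hence a Lagrangian on $\mathbb R\times\mathbb S^1$. All infima below are over absolutely continuous curves. For $x,y\in\mathbb R$ put $$\beta(y;x)=\inf_{T\ge 0,\ \gamma:[0,T]\to\mathbb R,\ \gamma(0)=x,\ \gamma(T)=y}\int_0^T L(\dot\gamma,\gamma)\,dt ,$$ and for $x,y\in\mathbb S^1$ define the Peierls barrier $$h(y;x)=\liminf_{T\to+\infty}\ \inf_{\gamma:[0,T]\to\mathbb S^1,\ \gamma(0)=x,\ \gamma(T)=y}\int_0^T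 L(\dot\gamma,\gamma)\,dt .$$ For $1\le i,j\le k$ let $\tilde h_R(x_i;x_{j+1})$ be $\beta(x_i;x_{j+1})$ if $j<i$ and $\beta(x_{i+k};x_{j+1})$ if $j\ge i$, and let $\tilde h_L(x_i;x_j)$ be $\beta(x_i;x_j)$ if $j\ge i$ and $\beta(x_{i-k};x_j)$ if $j<i$. Set $$W_i=\min_{1\le j\le k}\bigl(\tilde h_R(x_i;x_{j+1})+\tilde h_L(x_i;x_j)\bigr),\qquad W(x)=\min_{1\le j\le k}\bigl(W_j+h(x;x_j)\bigr),\quad x\in\mathbb S^1 .$$ A backward calibrated curve for $W$ is a continuous, piecewise $C^1$ curve $\gamma:(-\infty,0]\to\mathbb S^1$ with $W(\gamma(b))-W(\gamma(a))=\int_a^b L(\dot\gamma,\gamma)\,dt$ for all $a<b\le 0$. The projected Aubry set is $\mathcal A=\{x\in\mathbb S^1: h(x;x)=0\}$. A Mather measure is a Borel probability measure on $\mathbb R\times\mathbb S^1$ that is invariant under the Euler–Lagrange flow of $L$ and minimizes $\int L\,d\mu$ among all such invariant probability measures. The projected Mather set $\mathcal M_0$ is the image in $\mathbb S^1$ of the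 closure of the union of the supports of all Mather measures. Then: (i) for each $x\in\mathbb S^1$ there is a backward calibrated curve $\gamma$ for $W$ with $\gamma(0)=x$ that solves $\dot\gamma=U'(\gamma)$ on $(-\infty,0]$ or solves $\dot\gamma=-U'(\gamma)$ on $(-\infty,0]$, and $\gamma(t)$ converges to a critical point of $U$ as $t\to-\infty$; (ii) $\mathcal M_0=\mathcal A=\{x_i,\,x_{i+\frac12}\,;\ i=1,\dots,k\}$ as subsets of $\mathbb S^1$, that is, the set of all local minima and maxima of $U$. -/

import Mathlib

open scoped ENNReal ContDiff Topology
open MeasureTheory Filter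

noncomputable section

/- The circle is `UnitAddCircle = ℝ / ℤ`. A curve on the circle is given by a (continuous) lift
`γ : ℝ → ℝ`; its position on the circle at time `t` is `(γ t : UnitAddCircle)`. As `U'` is
1-periodic, the Lagrangian is the same along every lift. -/

/-- The Lagrangian `L(s, x) = (s + U'(x))² / 4`, the convex conjugate of `H(p, x) = p (p - U'(x))`. -/
def lagrangian (U : ℝ → ℝ) (s x : ℝ) : ℝ := (s + deriv U x) ^ 2 / 4

/-- The action `∫_a^b L(γ', γ) dt ∈ [0, ∞]` of a curve. -/
def action (U γ : ℝ → ℝ) (a b : ℝ) : ℝ≥0∞ :=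
  ∫⁻ t in Set.Icc a b, ENNReal.ofReal (lagrangian U (deriv γ t) (γ t))

/-- The least action from `x` to `y` in the universal cover `ℝ`, the duration `T ≥ 0` being free.
For `x ≤ y` it is the right barrier `h_R(y; x)`, for `y ≤ x` the left barrier `h_L(y; x)`. -/
def coverBarrier (U : ℝ → ℝ) (y x : ℝ) : ℝ≥0∞ :=
  ⨅ (T : ℝ) (γ : ℝ → ℝ) (_ : 0 ≤ T) (_ : AbsolutelyContinuousOnInterval γ 0 T)
    (_ : γ 0 = x) (_ : γ T = y), action U γ 0 T

/-- The least action from `x` to `y` on the circle in time exactly `T`. -/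
def leastAction (U : ℝ → ℝ) (T : ℝ) (y x : UnitAddCircle) : ℝ≥0∞ :=
  ⨅ (γ : ℝ → ℝ) (_ : AbsolutelyContinuousOnInterval γ 0 T)
    (_ : (γ 0 : UnitAddCircle) = x) (_ : (γ T : UnitAddCircle) = y), action U γ 0 T

/-- The Peierls barrier `h(y; x)`. -/
def peierlsBarrier (U : ℝ → ℝ) (y x : UnitAddCircle) : ℝ≥0∞ :=
  liminf (fun T : ℝ => leastAction U T y x) atTop

/-- The cost of the counterclockwise path on the circle from the minimum `x_{j+1}` to `x_i`,
where `1 ≤ i, j ≤ k` and `m i = x_i`. -/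
def ccwCost (U : ℝ → ℝ) (k : ℕ) (m : ℤ → ℝ) (i j : ℤ) : ℝ≥0∞ :=
  if j < i then coverBarrier U (m i) (m (j + 1)) else coverBarrier U (m (i + k)) (m (j + 1))

/-- The cost of the clockwise path on the circle from the minimum `x_j` to `x_i`. -/
def cwCost (U : ℝ → ℝ) (k : ℕ) (m : ℤ → ℝ) (i j : ℤ) : ℝ≥0∞ :=
  if i ≤ j then coverBarrier U (m i) (m j) else coverBarrier U (m (i - k)) (m j)

/-- The Freidlin-Wentzell boundary value `W_i` at the minimum `x_i`. -/
def boundaryValue (U : ℝ → ℝ) (k : ℕ) (m : ℤ → ℝ) (i : ℤ) : ℝ≥0∞ :=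
  ⨅ j ∈ Finset.Icc (1 : ℤ) k, (ccwCost U k m i j + cwCost U k m i j)

/-- The Freidlin-Wentzell landscape `W(x) = min_j (W_j + h(x; x_j))`. -/
def landscape (U : ℝ → ℝ) (k : ℕ) (m : ℤ → ℝ) (x : UnitAddCircle) : ℝ :=
  (⨅ j ∈ Finset.Icc (1 : ℤ) k,
    (boundaryValue U k m j + peierlsBarrier U x (m j : UnitAddCircle))).toReal

/-- `γ` is continuous and piecewise `C¹` (up to the break points) on `[a, b]`. -/
def PiecewiseC1On (γ : ℝ → ℝ) (a b : ℝ) : Prop :=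
  ContinuousOn γ (Set.Icc a b) ∧
    ∃ (n : ℕ) (τ : ℕ → ℝ), Monotone τ ∧ τ 0 = a ∧ τ n = b ∧
      ∀ i < n, ContDiffOn ℝ 1 γ (Set.Icc (τ i) (τ (i + 1)))

/-- `γ : (-∞, 0] → 𝕊¹` (given by a lift, of which only the values at `t ≤ 0` matter) is a backward
calibrated curve for `u`. -/
def IsCalibratedCurve (U : ℝ → ℝ) (u : UnitAddCircle → ℝ) (γ : ℝ → ℝ) : Prop :=
  (∀ a ≤ 0, PiecewiseC1On γ a 0) ∧
    ∀ a b : ℝ, a < b → b ≤ 0 →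
      u (γ b : UnitAddCircle) - u (γ a : UnitAddCircle) =
        ∫ t in a..b, lagrangian U (deriv γ t) (γ t)

/-- The projected Aubry set `{x | h(x; x) = 0}`. -/
def projectedAubrySet (U : ℝ → ℝ) : Set UnitAddCircle :=
  {x | peierlsBarrier U x x = 0}

/-- `γ` solves the Euler-Lagrange equation `d/dt ∂_s L(γ', γ) = ∂_x L(γ', γ)`. -/
def IsEulerLagrangeCurve (U : ℝ → ℝ) (γ : ℝ → ℝ) : Prop :=
  ContDiff ℝ 2 γ ∧ ∀ t : ℝ,
    deriv (fun r => deriv (fun s => lagrangian U s (γ r)) (deriv γ r)) t =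
      deriv (fun z => lagrangian U (deriv γ t) z) (γ t)

/-- The point `(γ'(t), γ(t))` of the tangent bundle `ℝ × 𝕊¹`. -/
def tangentLift (γ : ℝ → ℝ) (t : ℝ) : ℝ × UnitAddCircle := (deriv γ t, (γ t : UnitAddCircle))

/-- The preimage of `B` under the time-`t` map of the Euler-Lagrange flow on `ℝ × 𝕊¹`. -/
def flowPreimage (U : ℝ → ℝ) (t : ℝ) (B : Set (ℝ × UnitAddCircle)) :
    Set (ℝ × UnitAddCircle) :=
  {p | ∃ γ : ℝ → ℝ, IsEulerLagrangeCurve U γ ∧ tangentLift γ 0 = p ∧ tangentLift γ t ∈ B}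

/-- `μ` is a probability measure on `ℝ × 𝕊¹` that is invariant under the Euler-Lagrange flow. -/
def IsInvariantProb (U : ℝ → ℝ) (μ : Measure (ℝ × UnitAddCircle)) : Prop :=
  IsProbabilityMeasure μ ∧
    ∀ (t : ℝ) (B : Set (ℝ × UnitAddCircle)), MeasurableSet B → μ (flowPreimage U t B) = μ B

/-- The average action `∫ L dμ` (the point `x` of the circle being represented in `[0, 1)`). -/
def averageAction (U : ℝ → ℝ) (μ : Measure (ℝ × UnitAddCircle)) : ℝ≥0∞ :=
  ∫⁻ p, ENNReal.ofReal (lagrangian U p.1 (AddCircle.equivIco (1 : ℝ) 0 p.2 : ℝ)) ∂μ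

/-- Mather measures: the invariant probability measures of least average action. -/
def IsMatherMeasure (U : ℝ → ℝ) (μ : Measure (ℝ × UnitAddCircle)) : Prop :=
  IsInvariantProb U μ ∧ ∀ ν, IsInvariantProb U ν → averageAction U μ ≤ averageAction U ν

/-- The Mather set: the closure of the union of the supports of all Mather measures. -/
def matherSet (U : ℝ → ℝ) : Set (ℝ × UnitAddCircle) :=
  closure {p | ∃ μ, IsMatherMeasure U μ ∧ p ∈ μ.support}

/-- The projected Mather set. -/
def projectedMatherSet (U : ℝ → ℝ) : Set UnitAddCircle := Prod.snd '' matherSet U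

end

/- The barriers are bounded below by Fenchel duality: if `Ψ'(x) s ≤ L(s, x)` for all `s` and `x`,
then a curve from `x` to `y` costs at least `Ψ y - Ψ x`. The extreme such `Ψ` are the primitives of
`max(U', 0)` and of `min(U', 0)`, and monotone solutions of `γ' = ±U'(γ)` attain equality for the
former when they move right and for the latter when they move left.

(i) Resting at a critical point is free, so `h(·; c)` is the Mañé potential issued from a critical
point `c`, and `W` is the lower envelope of its own values on the critical set plus these barriers.
A nearly optimal curve from the critical set to `x` arrives from the left or from the right, and so
crosses every point of the critical-point-free interval on that side. Hence the monotone solution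
which is at `x` at time `0` and comes from that side is calibrated; it is trapped between critical
points, so it converges as `t → -∞`.

(ii) A loop around the circle costs at least the increment of a primitive of `max(U', 0)` or
`-min(U', 0)` over a period. A contractible loop based at a non-critical point either stays close to
it, where `L ≥ U' s / 2 + U'² / 4`, or pays `∫ |U'|` on the way out and back. In both cases the cost
of loops of duration at least `1` is bounded away from `0`. Finally, Dirac masses at critical points
have zero average action; therefore every Mather measure has zero average action and lives on the
graph `s = -U'(x)`, where the flow drifts along injective trajectories away from the critical
points. -/

noncomputable section

open Set

theorem absolutelyContinuousOnInterval_const {X : Type*} [PseudoMetricSpace X] (c : X) (a b : ℝ) :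
    AbsolutelyContinuousOnInterval (fun _ : ℝ => c) a b :=
  (LipschitzWith.const c).lipschitzOnWith.absolutelyContinuousOnInterval

theorem absolutelyContinuousOnInterval_locallyLipschitz_comp {F Y : Type*}
    [SeminormedAddCommGroup F] [PseudoMetricSpace Y] {g : F → Y} {f : ℝ → F} {a b : ℝ}
    (hg : LocallyLipschitz g) (hf : AbsolutelyContinuousOnInterval f a b) :
    AbsolutelyContinuousOnInterval (g ∘ f) a b := by
  have hcompact : IsCompact (f '' uIcc a b) := isCompact_uIcc.image_of_continuousOn hf.continuousOn
  obtain ⟨K, hK⟩ := hg.locallyLipschitzOn.exists_lipschitzOnWith_of_compact hcompact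
  rw [absolutelyContinuousOnInterval_iff] at hf ⊢
  intro ε hε
  obtain ⟨δ, hδ, hfδ⟩ := hf (ε / (K + 1)) (by positivity)
  refine ⟨δ, hδ, fun E hE hlength => ?_⟩
  calc ∑ i ∈ Finset.range E.1, dist (g (f (E.2 i).1)) (g (f (E.2 i).2))
      ≤ ∑ i ∈ Finset.range E.1, (K + 1) * dist (f (E.2 i).1) (f (E.2 i).2) := by
        refine Finset.sum_le_sum fun i hi => ?_
        have hmem := hE.1 i hi
        have := hK.dist_le_mul _ (mem_image_of_mem f hmem.1) _ (mem_image_of_mem f hmem.2)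
        exact this.trans (by gcongr; exact le_add_of_nonneg_right zero_le_one)
    _ < (K + 1) * (ε / (K + 1)) := by
        rw [← Finset.mul_sum]
        exact mul_lt_mul_of_pos_left (hfδ E hE hlength) (by positivity)
    _ = ε := by field_simp

theorem absolutelyContinuousOnInterval_comp_monotone {X : Type*} [PseudoMetricSpace X]
    {f : ℝ → X} {φ : ℝ → ℝ} {a b c d : ℝ} (hf : AbsolutelyContinuousOnInterval f c d)
    (hφ : AbsolutelyContinuousOnInterval φ a b) (hmono : Monotone φ)
    (hmaps : MapsTo φ (uIcc a b) (uIcc c d)) :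
    AbsolutelyContinuousOnInterval (f ∘ φ) a b := by
  rw [absolutelyContinuousOnInterval_iff] at hf hφ ⊢
  intro ε hε
  obtain ⟨δ, hδ, hfδ⟩ := hf ε hε
  obtain ⟨δ', hδ', hφδ⟩ := hφ δ hδ
  refine ⟨δ', hδ', fun E hE hlength => ?_⟩
  refine hfδ (E.1, fun i => (φ (E.2 i).1, φ (E.2 i).2)) ⟨fun i hi => ?_, ?_⟩ (hφδ E hE hlength)
  · exact ⟨hmaps (hE.1 i hi).1, hmaps (hE.1 i hi).2⟩
  · intro i hi j hj hij
    have hdisj := hE.2 hi hj hij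
    simp only [Function.onFun, uIoc, Ioc_disjoint_Ioc, ← hmono.map_min,
      ← hmono.map_max] at hdisj ⊢
    exact hmono hdisj

theorem absolutelyContinuousOnInterval_comp_add_const {X : Type*} [PseudoMetricSpace X]
    {f : ℝ → X} {a b : ℝ} (d : ℝ) (hf : AbsolutelyContinuousOnInterval f (a + d) (b + d)) :
    AbsolutelyContinuousOnInterval (fun t => f (t + d)) a b := by
  refine absolutelyContinuousOnInterval_comp_monotone (φ := (· + d)) hf ?_
    (fun s t h => add_le_add_left h d) fun t ht => ?_
  · exact (contDiff_id.add contDiff_const).contDiffOn.absolutelyContinuousOnInterval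
  · rw [← image_add_const_uIcc]
    exact mem_image_of_mem _ ht

theorem exists_absolutelyContinuousOnInterval_concat {F : Type*} [SeminormedAddCommGroup F]
    {f g : ℝ → F} {a b c : ℝ} (hab : a ≤ b) (hbc : b ≤ c)
    (hf : AbsolutelyContinuousOnInterval f a b) (hg : AbsolutelyContinuousOnInterval g b c)
    (hfg : f b = g b) :
    ∃ η : ℝ → F, AbsolutelyContinuousOnInterval η a c ∧ EqOn η f (Iic b) ∧ EqOn η g (Ici b) := by
  have hmin : AbsolutelyContinuousOnInterval (f ∘ (min · b)) a c := by
    refine absolutelyContinuousOnInterval_comp_monotone hf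
      (LipschitzWith.id.min_const b).lipschitzOnWith.absolutelyContinuousOnInterval
      (fun s t h => min_le_min_right _ h) fun t ht => ?_
    rw [uIcc_of_le hab]
    rw [uIcc_of_le (hab.trans hbc)] at ht
    exact ⟨le_min ht.1 hab, min_le_right _ _⟩
  have hmax : AbsolutelyContinuousOnInterval (g ∘ (max · b)) a c := by
    refine absolutelyContinuousOnInterval_comp_monotone hg
      (LipschitzWith.id.max_const b).lipschitzOnWith.absolutelyContinuousOnInterval
      (fun s t h => max_le_max_right _ h) fun t ht => ?_
    rw [uIcc_of_le hbc]
    rw [uIcc_of_le (hab.trans hbc)] at ht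
    exact ⟨le_max_right _ _, max_le ht.2 hbc⟩
  refine ⟨_, (hmin.add hmax).sub (absolutelyContinuousOnInterval_const (g b) a c),
    fun t (ht : t ≤ b) => ?_, fun t (ht : b ≤ t) => ?_⟩
  · simp [min_eq_left ht, max_eq_right ht]
  · simp [min_eq_right ht, max_eq_left ht, hfg]

theorem ofReal_integral_le_lintegral_ofReal {α : Type*} [MeasurableSpace α] {μ : Measure α}
    {f : α → ℝ} (hf : Integrable f μ) :
    ENNReal.ofReal (∫ x, f x ∂μ) ≤ ∫⁻ x, ENNReal.ofReal (f x) ∂μ := by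
  refine ENNReal.ofReal_le_of_le_toReal ?_
  rw [integral_eq_lintegral_pos_part_sub_lintegral_neg_part hf]
  exact sub_le_self _ ENNReal.toReal_nonneg

theorem exists_eq_add_intCast_of_coe_eq {x y : ℝ} (h : (x : UnitAddCircle) = y) :
    ∃ n : ℤ, x = y + n := by
  obtain ⟨n, hn⟩ := (AddCircle.coe_eq_zero_iff (1 : ℝ)).1
    (show ((x - y : ℝ) : UnitAddCircle) = 0 by simp [h])
  exact ⟨n, by simp only [zsmul_eq_mul, mul_one] at hn; linarith⟩

theorem intervalIntegral_pos_of_periodic {f : ℝ → ℝ} {T : ℝ} (hper : Function.Periodic f T)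
    (hT : 0 < T) (hf : Continuous f) (hnonneg : ∀ x, 0 ≤ f x) (hpos : ∃ x, 0 < f x) (a : ℝ) :
    0 < ∫ t in a..a + T, f t := by
  obtain ⟨x, hx⟩ := hpos
  rw [hper.intervalIntegral_add_eq a x]
  exact intervalIntegral.integral_pos (lt_add_of_pos_right x hT) hf.continuousOn
    (fun t _ => hnonneg t) ⟨x, left_mem_Icc.2 (le_add_of_nonneg_right hT.le), hx⟩

theorem mul_abs_sub_le_abs_integral {f : ℝ → ℝ} {x y c : ℝ} (hf : Continuous f)
    (hle : ∀ t ∈ uIcc x y, c ≤ f t) : c * |y - x| ≤ |∫ t in x..y, f t| := by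
  wlog hxy : x ≤ y generalizing x y
  · rw [abs_sub_comm, intervalIntegral.integral_symm, abs_neg]
    exact this (uIcc_comm x y ▸ hle) (le_of_not_ge hxy)
  rw [uIcc_of_le hxy] at hle
  calc c * |y - x| = ∫ _ in x..y, c := by
        rw [intervalIntegral.integral_const, smul_eq_mul, abs_of_nonneg (sub_nonneg.2 hxy),
          mul_comm]
    _ ≤ ∫ t in x..y, f t := intervalIntegral.integral_mono_on hxy intervalIntegrable_const
        (hf.intervalIntegrable x y) hle
    _ ≤ |∫ t in x..y, f t| := le_abs_self _

theorem sub_add_intCast_eq_mul_of_periodic_deriv {Ψ : ℝ → ℝ} (hΨ : ContDiff ℝ 1 Ψ)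
    (hper : Function.Periodic (deriv Ψ) 1) (n : ℤ) (x : ℝ) :
    Ψ (x + n) - Ψ x = n * (Ψ 1 - Ψ 0) := by
  have hFTC (a b : ℝ) : ∫ t in a..b, deriv Ψ t = Ψ b - Ψ a :=
    intervalIntegral.integral_deriv_eq_sub (fun t _ => hΨ.differentiable one_ne_zero t)
      ((hΨ.continuous_deriv le_rfl).intervalIntegrable a b)
  have h := hper.intervalIntegral_add_zsmul_eq n x (fun a b =>
    (hΨ.continuous_deriv le_rfl).intervalIntegrable a b)
  rw [hper.intervalIntegral_add_eq x 0] at h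
  simpa [hFTC] using h

section IntegralCurves

variable {E : Type*} [NormedAddCommGroup E] [NormedSpace ℝ E] {K : NNReal}

theorem exists_isIntegralCurve_of_bounded [CompleteSpace E] {v : E → E} {C : NNReal}
    (hv : ContDiff ℝ 1 v) (hK : LipschitzWith K v) (hC : ∀ x, ‖v x‖ ≤ C) (x : E) :
    ∃ γ : ℝ → E, γ 0 = x ∧ IsIntegralCurve γ fun _ => v := by
  have hlocal (N : ℝ) : ∃ γ : ℝ → E, γ 0 = x ∧
      IsMIntegralCurveOn (I := modelWithCornersSelf ℝ E) γ v (Ioo (-N) N) := by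
    rcases le_or_gt N 0 with hN | hN
    · exact ⟨fun _ => x, rfl, fun t ht => by linarith [ht.1, ht.2]⟩
    have hpl : IsPicardLindelof (fun _ => v) (tmin := -N) (tmax := N)
        ⟨0, by constructor <;> linarith⟩ x (C * N.toNNReal) 0 C K :=
      .of_time_independent (fun y _ => hC y) hK.lipschitzOnWith
        (by simp [Real.coe_toNNReal _ hN.le])
    obtain ⟨γ, hγx, hγ⟩ := hpl.exists_eq_forall_mem_Icc_hasDerivWithinAt₀
    exact ⟨γ, hγx, fun t ht => hasMFDerivWithinAt_iff_hasFDerivWithinAt.2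
      ((hγ t (Ioo_subset_Icc_self ht)).mono Ioo_subset_Icc_self).hasFDerivWithinAt⟩
  obtain ⟨γ, hγx, hγ⟩ := (exists_isMIntegralCurve_iff_exists_isMIntegralCurveOn_Ioo
    (contMDiff_vectorSpace_iff_contDiff.2 hv) x).2 hlocal
  exact ⟨γ, hγx, fun t =>
    hasDerivAt_iff_hasFDerivAt.2 (hasMFDerivAt_iff_hasFDerivAt.1 (hγ t))⟩

theorem isIntegralCurve_unique_of_lipschitzWith {v : E → E} (hK : LipschitzWith K v)
    {γ η : ℝ → E} (hγ : IsIntegralCurve γ fun _ => v) (hη : IsIntegralCurve η fun _ => v) {t₀ : ℝ}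
    (h : γ t₀ = η t₀) : γ = η :=
  ODE_solution_unique_univ (s := fun _ => univ) (fun _ => hK.lipschitzOnWith)
    (fun t => ⟨hγ t, trivial⟩) (fun t => ⟨hη t, trivial⟩) h

theorem isIntegralCurve_comp_neg {v : E → E} {γ : ℝ → E} (hγ : IsIntegralCurve γ fun _ => v) :
    IsIntegralCurve (fun t => γ (-t)) fun _ => -v := fun t => by
  simpa [Function.comp_def] using (hγ (-t)).scomp t (hasDerivAt_neg t)

theorem contDiff_two_of_isIntegralCurve {v : E → E} {γ : ℝ → E} (hv : ContDiff ℝ 1 v)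
    (hγ : IsIntegralCurve γ fun _ => v) : ContDiff ℝ 2 γ := by
  have hderiv : deriv γ = v ∘ γ := funext fun t => (hγ t).deriv
  have hdiff : Differentiable ℝ γ := fun t => (hγ t).differentiableAt
  have hγ1 : ContDiff ℝ 1 γ :=
    contDiff_one_iff_deriv.2 ⟨hdiff, hderiv ▸ hv.continuous.comp hγ.continuous⟩
  rw [← one_add_one_eq_two, contDiff_succ_iff_deriv]
  exact ⟨hdiff, by simp, hderiv ▸ hv.comp hγ1⟩

theorem ne_zero_of_isIntegralCurve {v : E → E} {γ : ℝ → E} (hK : LipschitzWith K v)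
    (hγ : IsIntegralCurve γ fun _ => v) {s : ℝ} (hs : v (γ s) ≠ 0) (t : ℝ) : v (γ t) ≠ 0 :=
  fun ht => hs <| by
    have hconst := isIntegralCurve_unique_of_lipschitzWith (t₀ := t) hK hγ
      (isIntegralCurve_const fun _ => ht) rfl
    rwa [← congrFun hconst s] at ht

variable {v γ : ℝ → ℝ}

theorem eq_const_of_isIntegralCurve_of_mem_uIcc (hK : LipschitzWith K v)
    (hγ : IsIntegralCurve γ fun _ => v) {c s t : ℝ} (hc : v c = 0) (hmem : c ∈ uIcc (γ s) (γ t)) :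
    γ = fun _ => c := by
  obtain ⟨r, -, hr⟩ := intermediate_value_uIcc hγ.continuous.continuousOn hmem
  exact isIntegralCurve_unique_of_lipschitzWith hK hγ (isIntegralCurve_const fun _ => hc) hr

theorem equilibrium_le_of_isIntegralCurve (hK : LipschitzWith K v)
    (hγ : IsIntegralCurve γ fun _ => v) {c s : ℝ} (hc : v c = 0) (hs : c ≤ γ s) (t : ℝ) :
    c ≤ γ t := by
  by_contra! ht
  have hγc := eq_const_of_isIntegralCurve_of_mem_uIcc hK hγ hc (mem_uIcc_of_ge ht.le hs)
  exact ht.ne (congrFun hγc t)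

theorem le_equilibrium_of_isIntegralCurve (hK : LipschitzWith K v)
    (hγ : IsIntegralCurve γ fun _ => v) {c s : ℝ} (hc : v c = 0) (hs : γ s ≤ c) (t : ℝ) :
    γ t ≤ c := by
  by_contra! ht
  have hγc := eq_const_of_isIntegralCurve_of_mem_uIcc hK hγ hc (mem_uIcc_of_le hs ht.le)
  exact ht.ne' (congrFun hγc t)

theorem monotone_or_antitone_of_isIntegralCurve (hK : LipschitzWith K v)
    (hγ : IsIntegralCurve γ fun _ => v) : Monotone γ ∨ Antitone γ := by
  have hdiff : Differentiable ℝ γ := fun t => (hγ t).differentiableAt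
  have hsign : (∀ t, 0 ≤ deriv γ t) ∨ ∀ t, deriv γ t ≤ 0 := by
    simp only [(hγ _).deriv]
    by_contra! ⟨⟨s, hs⟩, t, ht⟩
    obtain ⟨r, hr⟩ := mem_range_of_exists_le_of_exists_ge (hK.continuous.comp hγ.continuous)
      ⟨s, hs.le⟩ ⟨t, ht.le⟩
    have hγr := eq_const_of_isIntegralCurve_of_mem_uIcc (s := r) (t := r) hK hγ hr (by simp)
    exact hs.ne ((congrArg v (congrFun hγr s)).trans hr)
  exact hsign.imp (monotone_of_deriv_nonneg hdiff) (antitone_of_deriv_nonpos hdiff)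

theorem eq_zero_of_isIntegralCurve_of_tendsto_atBot (hv : Continuous v)
    (hγ : IsIntegralCurve γ fun _ => v) {c : ℝ} (hc : Tendsto γ atBot (𝓝 c)) : v c = 0 := by
  have hmean (t : ℝ) : ∃ r ∈ Ioo t (t + 1), v (γ r) = γ (t + 1) - γ t := by
    simpa using exists_hasDerivAt_eq_slope γ (v ∘ γ) (lt_add_one t) hγ.continuous.continuousOn
      fun r _ => hγ r
  choose r hr hvr using hmean
  have hshift : Tendsto (fun t : ℝ => t + 1) atBot atBot :=
    tendsto_atBot_add_const_right _ 1 tendsto_id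
  have hr' : Tendsto r atBot atBot := tendsto_atBot_mono (fun t => (hr t).2.le) hshift
  have hlim : Tendsto (fun t => v (γ (r t))) atBot (𝓝 (c - c)) := by
    simp only [hvr]
    exact (hc.comp hshift).sub hc
  rw [sub_self] at hlim
  exact tendsto_nhds_unique ((hv.tendsto c).comp (hc.comp hr')) hlim

theorem eq_zero_of_hasDerivAt_mul {a w : ℝ → ℝ} (ha : Continuous a)
    (hw : ∀ t, HasDerivAt w (a t * w t) t) {t₀ : ℝ} (h₀ : w t₀ = 0) (t : ℝ) : w t = 0 := by
  have hexp (t : ℝ) : HasDerivAt (fun t => Real.exp (-∫ r in t₀..t, a r))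
      (Real.exp (-∫ r in t₀..t, a r) * -a t) t :=
    (ha.integral_hasStrictDerivAt t₀ t).hasDerivAt.neg.exp
  have hconst (t : ℝ) : HasDerivAt (fun t => Real.exp (-∫ r in t₀..t, a r) * w t) 0 t := by
    have h := (hexp t).mul (hw t)
    rwa [mul_neg, neg_mul, mul_assoc, neg_add_cancel] at h
  have h := is_const_of_deriv_eq_zero (fun t => (hconst t).differentiableAt)
    (fun t => (hconst t).deriv) t t₀
  simpa [h₀] using h

theorem injective_of_isIntegralCurve (hγ : IsIntegralCurve γ fun _ => v)
    (hne : ∀ t, v (γ t) ≠ 0) : Function.Injective γ :=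
  Function.Injective.of_lt_imp_ne fun s t hst h => by
    obtain ⟨r, -, hr⟩ := exists_hasDerivAt_eq_zero hst hγ.continuous.continuousOn h
      fun r _ => hγ r
    exact hne r hr

theorem isOpenMap_of_isIntegralCurve (hv : ContDiff ℝ 1 v) (hγ : IsIntegralCurve γ fun _ => v)
    (hne : ∀ t, v (γ t) ≠ 0) : IsOpenMap γ :=
  isOpenMap_of_hasStrictDerivAt (fun t => (contDiff_two_of_isIntegralCurve hv
    hγ).contDiffAt.hasStrictDerivAt' (hγ t) two_ne_zero) hne

theorem injective_coe_of_isIntegralCurve (hper : Function.Periodic v 1) (hK : LipschitzWith K v)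
    (hγ : IsIntegralCurve γ fun _ => v) (hne : ∀ t, v (γ t) ≠ 0) (hzero : ∃ c, v c = 0) :
    Function.Injective fun t => (γ t : UnitAddCircle) := by
  obtain ⟨c, hc⟩ := hzero
  obtain ⟨l, hl, hcl⟩ := hper.exists_mem_Ioc one_pos c (γ 0 - 1)
  rw [sub_add_cancel] at hl
  have hl0 : v l = 0 := hcl.symm.trans hc
  have hl1 : v (l + 1) = 0 := (hper l).trans hl0
  have htrap (t : ℝ) : γ t ∈ Ico l (l + 1) :=
    ⟨equilibrium_le_of_isIntegralCurve hK hγ hl0 hl.2 t,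
      (le_equilibrium_of_isIntegralCurve hK hγ hl1 (sub_lt_iff_lt_add.1 hl.1).le t).lt_of_ne
        fun h => hne t (h ▸ hl1)⟩
  exact fun s t hst => injective_of_isIntegralCurve hγ hne
    ((AddCircle.coe_eq_coe_iff_of_mem_Ico (htrap s) (htrap t)).1 hst)

end IntegralCurves

theorem exists_norm_le_of_periodic {F : Type*} [SeminormedAddCommGroup F] {v : ℝ → F} {c : ℝ}
    (hper : Function.Periodic v c) (hc : c ≠ 0) (hv : Continuous v) :
    ∃ C : NNReal, ∀ x, ‖v x‖ ≤ C := by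
  obtain ⟨C, hC⟩ := (hper.isBounded_of_continuous hc hv).exists_norm_le
  exact ⟨C.toNNReal, fun x => (hC _ (mem_range_self x)).trans (Real.le_coe_toNNReal C)⟩

theorem exists_lipschitzWith_of_periodic {F : Type*} [NormedAddCommGroup F] [NormedSpace ℝ F]
    {v : ℝ → F} {c : ℝ} (hper : Function.Periodic v c) (hc : c ≠ 0) (hv : ContDiff ℝ 1 v) :
    ∃ K : NNReal, LipschitzWith K v := by
  have hper' : Function.Periodic (deriv v) c := fun x => by
    rw [← deriv_comp_add_const, hper.funext]
  obtain ⟨K, hK⟩ := exists_norm_le_of_periodic hper' hc (hv.continuous_deriv le_rfl)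
  exact ⟨K, lipschitzWith_of_nnnorm_deriv_le (hv.differentiable one_ne_zero) hK⟩

theorem exists_isIntegralCurve_of_periodic
    {v : ℝ → ℝ} {c : ℝ} (hper : Function.Periodic v c) (hc : c ≠ 0) (hv : ContDiff ℝ 1 v) (x : ℝ) :
    ∃ γ : ℝ → ℝ, γ 0 = x ∧ IsIntegralCurve γ fun _ => v := by
  obtain ⟨C, hC⟩ := exists_norm_le_of_periodic hper hc hv.continuous
  obtain ⟨K, hK⟩ := exists_lipschitzWith_of_periodic hper hc hv
  exact exists_isIntegralCurve_of_bounded hv hK hC x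

theorem exists_monotone_isIntegralCurve_of_periodic {v : ℝ → ℝ} {c : ℝ}
    (hper : Function.Periodic v c) (hc : c ≠ 0) (hv : ContDiff ℝ 1 v) (x : ℝ) :
    ∃ γ : ℝ → ℝ, γ 0 = x ∧ Monotone γ ∧
      ((IsIntegralCurve γ fun _ => v) ∨ IsIntegralCurve γ fun _ => -v) := by
  obtain ⟨γ, hγx, hγ⟩ := exists_isIntegralCurve_of_periodic hper hc hv x
  obtain ⟨K, hK⟩ := exists_lipschitzWith_of_periodic hper hc hv
  rcases monotone_or_antitone_of_isIntegralCurve hK hγ with hmono | hanti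
  · exact ⟨γ, hγx, hmono, .inl hγ⟩
  · exact ⟨fun t => γ (-t), by simpa using hγx, fun s t h => hanti (neg_le_neg h),
      .inr (isIntegralCurve_comp_neg hγ)⟩

variable {U γ : ℝ → ℝ}

theorem lagrangian_nonneg (U : ℝ → ℝ) (s x : ℝ) : 0 ≤ lagrangian U s x :=
  div_nonneg (sq_nonneg _) zero_le_four

theorem continuous_lagrangian (hU : Continuous (deriv U)) (hγ : ContDiff ℝ 1 γ) :
    Continuous fun t => lagrangian U (deriv γ t) (γ t) :=
  (((hγ.continuous_deriv le_rfl).add (hU.comp hγ.continuous)).pow 2).div_const 4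

theorem action_eq_ofReal_integral (hU : Continuous (deriv U)) (hγ : ContDiff ℝ 1 γ) {a b : ℝ}
    (hab : a ≤ b) :
    action U γ a b = ENNReal.ofReal (∫ t in a..b, lagrangian U (deriv γ t) (γ t)) := by
  rw [intervalIntegral.integral_of_le hab, ← integral_Icc_eq_integral_Ioc,
    ofReal_integral_eq_lintegral_ofReal (continuous_lagrangian hU hγ).integrableOn_Icc
      (ae_of_all _ fun t => lagrangian_nonneg _ _ _), action]

theorem action_congr {η : ℝ → ℝ} {a b : ℝ} (h : EqOn γ η (Ioo a b)) :
    action U γ a b = action U η a b := by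
  unfold action
  rw [← setLIntegral_congr Ioo_ae_eq_Icc, ← setLIntegral_congr Ioo_ae_eq_Icc]
  refine setLIntegral_congr_fun measurableSet_Ioo fun t ht => ?_
  simp only [(h.eventuallyEq_of_mem (Ioo_mem_nhds ht.1 ht.2)).deriv_eq, h ht]

theorem action_add_intCast (hper : Function.Periodic (deriv U) 1) (n : ℤ) (a b : ℝ) :
    action U (fun t => γ t + n) a b = action U γ a b := by
  have hforce (x : ℝ) : deriv U (x + n) = deriv U x := by simpa using hper.int_mul n x
  simp only [action, lagrangian, deriv_add_const, hforce]

theorem action_add (U γ : ℝ → ℝ) {a b c : ℝ} (hab : a ≤ b) (hbc : b ≤ c) :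
    action U γ a b + action U γ b c = action U γ a c := by
  unfold action
  rw [← Icc_union_Ioc_eq_Icc hab hbc, lintegral_union measurableSet_Ioc
    (disjoint_left.2 fun x hx hx' => hx'.1.not_ge hx.2), setLIntegral_congr Ioc_ae_eq_Icc]

theorem action_comp_add_const (U γ : ℝ → ℝ) (a b d : ℝ) :
    action U (fun t => γ (t + d)) a b = action U γ (a + d) (b + d) := by
  unfold action
  have h := (measurePreserving_add_right volume d).setLIntegral_comp_preimage_emb
    (measurableEmbedding_addRight d)
    (fun t => ENNReal.ofReal (lagrangian U (deriv γ t) (γ t))) (Icc (a + d) (b + d))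
  simpa [deriv_comp_add_const] using h

theorem action_const_of_deriv_eq_zero {c : ℝ} (hc : deriv U c = 0) (a b : ℝ) :
    action U (fun _ => c) a b = 0 := by
  simp [action, lagrangian, hc]

theorem ofReal_sub_add_mul_le_action {Ψ : ℝ → ℝ} {a b e : ℝ} (hab : a ≤ b)
    (hγ : AbsolutelyContinuousOnInterval γ a b) (hΨ : ContDiff ℝ 1 Ψ)
    (hle : ∀ t ∈ Icc a b, ∀ s, deriv Ψ (γ t) * s + e ≤ lagrangian U s (γ t)) :
    ENNReal.ofReal (Ψ (γ b) - Ψ (γ a) + e * (b - a)) ≤ action U γ a b := by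
  have hΨγ := absolutelyContinuousOnInterval_locallyLipschitz_comp hΨ.locallyLipschitz hγ
  have hint := hΨγ.intervalIntegrable_deriv
  have hint' : IntegrableOn (fun t => deriv (Ψ ∘ γ) t + e) (Icc a b) :=
    ((intervalIntegrable_iff_integrableOn_Icc_of_le hab).1 hint).add
      (integrableOn_const (by simp))
  calc ENNReal.ofReal (Ψ (γ b) - Ψ (γ a) + e * (b - a))
      = ENNReal.ofReal (∫ t in Icc a b, (deriv (Ψ ∘ γ) t + e)) := by
        rw [integral_Icc_eq_integral_Ioc, ← intervalIntegral.integral_of_le hab,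
          intervalIntegral.integral_add hint intervalIntegrable_const,
          hΨγ.integral_deriv_eq_sub, intervalIntegral.integral_const, smul_eq_mul, mul_comm e,
          Function.comp_apply, Function.comp_apply]
    _ ≤ ∫⁻ t in Icc a b, ENNReal.ofReal (deriv (Ψ ∘ γ) t + e) :=
        ofReal_integral_le_lintegral_ofReal hint'
    _ ≤ action U γ a b := by
        refine lintegral_mono_ae ?_
        have hdiff := hγ.ae_differentiableAt
        rw [uIcc_of_le hab] at hdiff
        filter_upwards [ae_restrict_of_ae hdiff, ae_restrict_mem measurableSet_Icc] with t ht htm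
        refine ENNReal.ofReal_le_ofReal ?_
        rw [((hΨ.differentiable one_ne_zero (γ t)).hasDerivAt.comp t (ht htm).hasDerivAt).deriv]
        exact hle t htm _

/-- A critical subsolution: a `C¹` function `Ψ` on the line with `1`-periodic derivative such that
`(x, Ψ'(x))` lies in the sublevel set `{H ≤ 0}` of the Hamiltonian. By Fenchel duality this is the
inequality `Ψ'(x) s ≤ L(s, x)`. -/
structure IsCriticalSubsolution (U Ψ : ℝ → ℝ) : Prop where
  contDiff : ContDiff ℝ 1 Ψ
  periodic_deriv : Function.Periodic (deriv Ψ) 1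
  deriv_mul_le : ∀ s x, deriv Ψ x * s ≤ lagrangian U s x

namespace IsCriticalSubsolution

variable {Ψ : ℝ → ℝ}

theorem ofReal_sub_le_action (hΨ : IsCriticalSubsolution U Ψ) {a b : ℝ} (hab : a ≤ b)
    (hγ : AbsolutelyContinuousOnInterval γ a b) :
    ENNReal.ofReal (Ψ (γ b) - Ψ (γ a)) ≤ action U γ a b := by
  simpa using ofReal_sub_add_mul_le_action (e := 0) hab hγ hΨ.contDiff
    fun t _ s => by simpa using hΨ.deriv_mul_le s (γ t)

theorem integral_lagrangian_eq_sub (hΨ : IsCriticalSubsolution U Ψ) (hγ : ContDiff ℝ 1 γ)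
    (hL : ∀ t, lagrangian U (deriv γ t) (γ t) = deriv Ψ (γ t) * deriv γ t) (a b : ℝ) :
    ∫ t in a..b, lagrangian U (deriv γ t) (γ t) = Ψ (γ b) - Ψ (γ a) := by
  simp only [hL]
  refine intervalIntegral.integral_eq_sub_of_hasDerivAt (f := Ψ ∘ γ) (fun t _ => ?_) ?_
  · exact (hΨ.contDiff.differentiable one_ne_zero _).hasDerivAt.comp t
      (hγ.differentiable one_ne_zero t).hasDerivAt
  · exact (((hΨ.contDiff.continuous_deriv le_rfl).comp hγ.continuous).mul
      (hγ.continuous_deriv le_rfl)).intervalIntegrable _ _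

end IsCriticalSubsolution

/-- The potential `∫₀ˣ max(U', 0)`, whose increments are the costs of moving right. -/
def rightPotential (U : ℝ → ℝ) (x : ℝ) : ℝ := ∫ t in (0 : ℝ)..x, max (deriv U t) 0

/-- The potential `∫₀ˣ min(U', 0)`, whose increments are the costs of moving left. -/
def leftPotential (U : ℝ → ℝ) (x : ℝ) : ℝ := ∫ t in (0 : ℝ)..x, min (deriv U t) 0

theorem hasDerivAt_rightPotential (hU : Continuous (deriv U)) (x : ℝ) :
    HasDerivAt (rightPotential U) (max (deriv U x) 0) x :=
  ((hU.max continuous_const).integral_hasStrictDerivAt 0 x).hasDerivAt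

theorem hasDerivAt_leftPotential (hU : Continuous (deriv U)) (x : ℝ) :
    HasDerivAt (leftPotential U) (min (deriv U x) 0) x :=
  ((hU.min continuous_const).integral_hasStrictDerivAt 0 x).hasDerivAt

theorem max_mul_le_lagrangian (U : ℝ → ℝ) (s x : ℝ) :
    max (deriv U x) 0 * s ≤ lagrangian U s x := by
  unfold lagrangian
  rcases max_cases (deriv U x) 0 with ⟨h, _⟩ | ⟨h, _⟩ <;> rw [h] <;>
    nlinarith [sq_nonneg (s - deriv U x), sq_nonneg (s + deriv U x)]

theorem min_mul_le_lagrangian (U : ℝ → ℝ) (s x : ℝ) :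
    min (deriv U x) 0 * s ≤ lagrangian U s x := by
  unfold lagrangian
  rcases min_cases (deriv U x) 0 with ⟨h, _⟩ | ⟨h, _⟩ <;> rw [h] <;>
    nlinarith [sq_nonneg (s - deriv U x), sq_nonneg (s + deriv U x)]

theorem deriv_rightPotential (hU : Continuous (deriv U)) :
    deriv (rightPotential U) = fun x => max (deriv U x) 0 :=
  funext fun x => (hasDerivAt_rightPotential hU x).deriv

theorem deriv_leftPotential (hU : Continuous (deriv U)) :
    deriv (leftPotential U) = fun x => min (deriv U x) 0 :=
  funext fun x => (hasDerivAt_leftPotential hU x).deriv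

theorem isCriticalSubsolution_rightPotential (hper : Function.Periodic (deriv U) 1)
    (hU : Continuous (deriv U)) : IsCriticalSubsolution U (rightPotential U) where
  contDiff := contDiff_one_iff_deriv.2 ⟨fun x => (hasDerivAt_rightPotential hU x).differentiableAt,
    deriv_rightPotential hU ▸ hU.max continuous_const⟩
  periodic_deriv := by
    rw [deriv_rightPotential hU]
    exact hper.comp (max · 0)
  deriv_mul_le s x := deriv_rightPotential hU ▸ max_mul_le_lagrangian U s x

theorem isCriticalSubsolution_leftPotential (hper : Function.Periodic (deriv U) 1)
    (hU : Continuous (deriv U)) : IsCriticalSubsolution U (leftPotential U) where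
  contDiff := contDiff_one_iff_deriv.2 ⟨fun x => (hasDerivAt_leftPotential hU x).differentiableAt,
    deriv_leftPotential hU ▸ hU.min continuous_const⟩
  periodic_deriv := by
    rw [deriv_leftPotential hU]
    exact hper.comp (min · 0)
  deriv_mul_le s x := deriv_leftPotential hU ▸ min_mul_le_lagrangian U s x

section Barriers

variable {x y z : UnitAddCircle}

theorem leastAction_le_action (U : ℝ → ℝ) {a b : ℝ} (hγ : AbsolutelyContinuousOnInterval γ a b) :
    leastAction U (b - a) (γ b) (γ a) ≤ action U γ a b := by
  have h := action_comp_add_const U γ 0 (b - a) a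
  rw [zero_add, sub_add_cancel] at h
  rw [← h]
  exact iInf₂_le_of_le (fun t => γ (t + a))
    (absolutelyContinuousOnInterval_comp_add_const a (by simpa using hγ))
    (iInf₂_le_of_le (by simp) (by simp) le_rfl)

theorem leastAction_le_action_add_action (hper : Function.Periodic (deriv U) 1) {η : ℝ → ℝ}
    {S T : ℝ} (hS : 0 ≤ S) (hT : 0 ≤ T) (hγ : AbsolutelyContinuousOnInterval γ 0 S)
    (hη : AbsolutelyContinuousOnInterval η 0 T) (hγη : (γ S : UnitAddCircle) = η 0) :
    leastAction U (S + T) (η T) (γ 0) ≤ action U γ 0 S + action U η 0 T := by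
  obtain ⟨n, hn⟩ := exists_eq_add_intCast_of_coe_eq hγη
  have hST : S ≤ S + T := le_add_of_nonneg_right hT
  have hη' : AbsolutelyContinuousOnInterval (fun t => η (t + -S) + n) S (S + T) :=
    (absolutelyContinuousOnInterval_comp_add_const (-S) (by simpa using hη)).add
      (absolutelyContinuousOnInterval_const (n : ℝ) _ _)
  obtain ⟨ζ, hζ, hζγ, hζη⟩ :=
    exists_absolutelyContinuousOnInterval_concat hS hST hγ hη' (by simpa using hn)
  have hζT : (ζ (S + T) : UnitAddCircle) = η T := by simp [hζη hST]
  calc leastAction U (S + T) (η T) (γ 0)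
      ≤ action U ζ 0 (S + T) := by
        simpa [hζT, hζγ hS] using leastAction_le_action U hζ
    _ = action U ζ 0 S + action U ζ S (S + T) := (action_add U ζ hS hST).symm
    _ = action U γ 0 S + action U η 0 T := by
        congr 1
        · exact action_congr fun t ht => hζγ ht.2.le
        · rw [action_congr fun t ht => hζη ht.1.le, action_add_intCast hper,
            action_comp_add_const, add_neg_cancel, add_neg_cancel_comm]

theorem leastAction_add_le (hper : Function.Periodic (deriv U) 1) {S T : ℝ} (hS : 0 ≤ S)
    (hT : 0 ≤ T) (x y z : UnitAddCircle) :
    leastAction U (S + T) z x ≤ leastAction U S y x + leastAction U T z y := by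
  conv_rhs => unfold leastAction
  simp only [ENNReal.iInf_add, ENNReal.add_iInf, le_iInf_iff]
  rintro η hη hηy rfl γ hγ rfl hγy
  exact leastAction_le_action_add_action hper hS hT hγ hη (hγy.trans hηy.symm)

/-- The Mañé potential: the least action from `x` to `y` on the circle, the duration being free. -/
def manePotential (U : ℝ → ℝ) (y x : UnitAddCircle) : ℝ≥0∞ :=
  ⨅ (T : ℝ) (_ : 0 ≤ T), leastAction U T y x

theorem manePotential_le_action (U : ℝ → ℝ) {a b : ℝ} (hab : a ≤ b)
    (hγ : AbsolutelyContinuousOnInterval γ a b) :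
    manePotential U (γ b) (γ a) ≤ action U γ a b :=
  iInf₂_le_of_le (b - a) (sub_nonneg.2 hab) (leastAction_le_action U hγ)

theorem manePotential_le_add (hper : Function.Periodic (deriv U) 1) (x y z : UnitAddCircle) :
    manePotential U z x ≤ manePotential U y x + manePotential U z y := by
  conv_rhs => unfold manePotential
  simp only [ENNReal.iInf_add, ENNReal.add_iInf, le_iInf_iff]
  exact fun T hT S hS =>
    iInf₂_le_of_le (S + T) (add_nonneg hS hT) (leastAction_add_le hper hS hT x y z)

theorem exists_curve_of_manePotential_lt (hper : Function.Periodic (deriv U) 1) {y : ℝ}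
    {a : ℝ≥0∞} (h : manePotential U y x < a) :
    ∃ (T : ℝ) (γ : ℝ → ℝ), 0 ≤ T ∧ AbsolutelyContinuousOnInterval γ 0 T ∧
      (γ 0 : UnitAddCircle) = x ∧ γ T = y ∧ action U γ 0 T < a := by
  simp only [manePotential, leastAction, iInf_lt_iff] at h
  obtain ⟨T, hT, γ, hγ, hγx, hγy, hlt⟩ := h
  obtain ⟨n, hn⟩ := exists_eq_add_intCast_of_coe_eq hγy.symm
  exact ⟨T, fun t => γ t + n, hT, hγ.add (absolutelyContinuousOnInterval_const _ _ _),
    by simpa using hγx, hn.symm, by rwa [action_add_intCast hper]⟩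

theorem exists_curve_action_ne_top (hU : Continuous (deriv U)) (x y : ℝ) :
    ∃ γ : ℝ → ℝ, AbsolutelyContinuousOnInterval γ 0 1 ∧ γ 0 = x ∧ γ 1 = y ∧
      action U γ 0 1 ≠ ⊤ := by
  have hline : ContDiff ℝ 1 fun t : ℝ => x + t * (y - x) := by fun_prop
  refine ⟨fun t => x + t * (y - x), hline.contDiffOn.absolutelyContinuousOnInterval, by simp,
    by simp, ?_⟩
  rw [action_eq_ofReal_integral hU hline zero_le_one]
  exact ENNReal.ofReal_ne_top

theorem manePotential_ne_top (hU : Continuous (deriv U)) (x y : UnitAddCircle) :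
    manePotential U y x ≠ ⊤ := by
  obtain ⟨x, rfl⟩ := QuotientAddGroup.mk_surjective x
  obtain ⟨y, rfl⟩ := QuotientAddGroup.mk_surjective y
  obtain ⟨γ, hγ, rfl, rfl, htop⟩ := exists_curve_action_ne_top hU x y
  exact ne_top_of_le_ne_top htop (manePotential_le_action U zero_le_one hγ)

/-- The points of the circle below the critical points of `U`. -/
def criticalSet (U : ℝ → ℝ) : Set UnitAddCircle :=
  (fun x : ℝ => (x : UnitAddCircle)) '' {x | deriv U x = 0}

theorem coe_mem_criticalSet_iff (hper : Function.Periodic (deriv U) 1) {x : ℝ} :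
    (x : UnitAddCircle) ∈ criticalSet U ↔ deriv U x = 0 := by
  refine ⟨?_, fun hx => ⟨x, hx, rfl⟩⟩
  rintro ⟨c, hc, hcx⟩
  obtain ⟨n, rfl⟩ := exists_eq_add_intCast_of_coe_eq hcx
  have hshift : deriv U (x + n) = deriv U x := by simpa using hper.int_mul n x
  exact hshift.symm.trans hc

theorem leastAction_self_eq_zero (hx : x ∈ criticalSet U) (T : ℝ) : leastAction U T x x = 0 := by
  obtain ⟨c, hc, rfl⟩ := hx
  have h := leastAction_le_action U (absolutelyContinuousOnInterval_const c 0 T)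
  rwa [action_const_of_deriv_eq_zero hc, sub_zero, nonpos_iff_eq_zero] at h

theorem manePotential_self_eq_zero (hx : x ∈ criticalSet U) : manePotential U x x = 0 :=
  nonpos_iff_eq_zero.1 (iInf₂_le_of_le 0 le_rfl (leastAction_self_eq_zero hx 0).le)

theorem leastAction_anti (hper : Function.Periodic (deriv U) 1) (hx : x ∈ criticalSet U)
    {S T : ℝ} (hS : 0 ≤ S) (hST : S ≤ T) : leastAction U T y x ≤ leastAction U S y x := by
  have h := leastAction_add_le hper (sub_nonneg.2 hST) hS x x y
  rwa [leastAction_self_eq_zero hx, zero_add, sub_add_cancel] at h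

theorem peierlsBarrier_eq_manePotential (hper : Function.Periodic (deriv U) 1)
    (hx : x ∈ criticalSet U) : peierlsBarrier U y x = manePotential U y x := by
  refine le_antisymm (le_iInf₂ fun T hT => ?_) ?_
  · refine liminf_le_of_frequently_le' (Eventually.frequently ?_)
    filter_upwards [eventually_ge_atTop T] with S hS using leastAction_anti hper hx hT hS
  · refine le_liminf_of_le (by isBoundedDefault) ?_
    filter_upwards [eventually_ge_atTop 0] with S hS using iInf₂_le S hS

/-- A function on the circle that is determined by its values on the critical set of `U`, as the
envelope of the barriers issued from there. -/
def IsCriticalEnvelope (U : ℝ → ℝ) (u : UnitAddCircle → ℝ≥0∞) : Prop :=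
  ∀ x, u x = ⨅ c ∈ criticalSet U, (u c + peierlsBarrier U x c)

theorem isCriticalEnvelope_iInf (hper : Function.Periodic (deriv U) 1) {ι : Sort*} (B : ι → ℝ≥0∞)
    {c : ι → UnitAddCircle} (hc : ∀ j, c j ∈ criticalSet U) :
    IsCriticalEnvelope U fun x => ⨅ j, (B j + peierlsBarrier U x (c j)) := by
  refine fun x => le_antisymm (le_iInf₂ fun d hd => ?_) (le_iInf fun j => ?_)
  · rw [ENNReal.iInf_add]
    refine iInf_mono fun j => ?_
    rw [add_assoc, peierlsBarrier_eq_manePotential hper (hc j),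
      peierlsBarrier_eq_manePotential hper (hc j), peierlsBarrier_eq_manePotential hper hd]
    gcongr
    exact manePotential_le_add hper _ _ _
  · refine iInf₂_le_of_le (c j) (hc j) ?_
    gcongr
    refine iInf_le_of_le j ?_
    rw [peierlsBarrier_eq_manePotential hper (hc j), manePotential_self_eq_zero (hc j), add_zero]

namespace IsCriticalEnvelope

variable {u : UnitAddCircle → ℝ≥0∞}

theorem le_add_manePotential (hu : IsCriticalEnvelope U u) (hper : Function.Periodic (deriv U) 1)
    (x y : UnitAddCircle) : u y ≤ u x + manePotential U y x := by
  rw [hu x, hu y]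
  simp only [ENNReal.iInf_add]
  refine iInf₂_mono fun c hc => ?_
  rw [add_assoc, peierlsBarrier_eq_manePotential hper hc, peierlsBarrier_eq_manePotential hper hc]
  gcongr
  exact manePotential_le_add hper _ _ _

theorem le_add_action (hu : IsCriticalEnvelope U u) (hper : Function.Periodic (deriv U) 1)
    {a b : ℝ} (hab : a ≤ b) (hγ : AbsolutelyContinuousOnInterval γ a b) :
    u (γ b) ≤ u (γ a) + action U γ a b :=
  (hu.le_add_manePotential hper _ _).trans (by gcongr; exact manePotential_le_action U hab hγ)

theorem ne_top (hu : IsCriticalEnvelope U u) (hper : Function.Periodic (deriv U) 1)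
    (hU : Continuous (deriv U)) (hx : u x ≠ ⊤) (y : UnitAddCircle) : u y ≠ ⊤ :=
  ne_top_of_le_ne_top (ENNReal.add_ne_top.2 ⟨hx, manePotential_ne_top hU x y⟩)
    (hu.le_add_manePotential hper x y)

theorem exists_curve_of_lt (hu : IsCriticalEnvelope U u) (hper : Function.Periodic (deriv U) 1)
    {x : ℝ} {a : ℝ≥0∞} (h : u x < a) :
    ∃ (T : ℝ) (γ : ℝ → ℝ), 0 ≤ T ∧ AbsolutelyContinuousOnInterval γ 0 T ∧
      deriv U (γ 0) = 0 ∧ γ T = x ∧ u (γ 0) + action U γ 0 T < a := by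
  rw [hu x] at h
  simp only [iInf_lt_iff] at h
  obtain ⟨c, hc, h⟩ := h
  rw [peierlsBarrier_eq_manePotential hper hc, add_comm, ← lt_tsub_iff_right] at h
  obtain ⟨T, γ, hT, hγ, rfl, hγx, hlt⟩ := exists_curve_of_manePotential_lt hper h
  exact ⟨T, γ, hT, hγ, (coe_mem_criticalSet_iff hper).1 hc, hγx,
    by rwa [add_comm, ← lt_tsub_iff_right]⟩

end IsCriticalEnvelope

theorem coverBarrier_ne_top (hU : Continuous (deriv U)) (x y : ℝ) : coverBarrier U y x ≠ ⊤ := by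
  obtain ⟨γ, hγ, hγx, hγy, htop⟩ := exists_curve_action_ne_top hU x y
  exact ne_top_of_le_ne_top htop (iInf₂_le_of_le 1 γ <| iInf₂_le_of_le zero_le_one hγ <|
    iInf₂_le_of_le hγx hγy le_rfl)

theorem boundaryValue_ne_top (hU : Continuous (deriv U)) {k : ℕ} (hk : 1 ≤ k) (m : ℤ → ℝ)
    (i : ℤ) : boundaryValue U k m i ≠ ⊤ := by
  have hmem : (1 : ℤ) ∈ Finset.Icc (1 : ℤ) k := Finset.mem_Icc.2 ⟨le_rfl, mod_cast hk⟩
  refine ne_top_of_le_ne_top (ENNReal.add_ne_top.2 ⟨?_, ?_⟩) (iInf₂_le 1 hmem)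
  · unfold ccwCost
    split_ifs <;> exact coverBarrier_ne_top hU _ _
  · unfold cwCost
    split_ifs <;> exact coverBarrier_ne_top hU _ _

end Barriers

/-- A solution of `γ' = U'(γ)` or of `γ' = -U'(γ)`. -/
def IsGradientCurve (U γ : ℝ → ℝ) : Prop :=
  (IsIntegralCurve γ fun _ => deriv U) ∨ IsIntegralCurve γ fun _ => -deriv U

theorem exists_monotone_isGradientCurve (hper : Function.Periodic (deriv U) 1)
    (hU : ContDiff ℝ 1 (deriv U)) (x : ℝ) :
    ∃ γ : ℝ → ℝ, γ 0 = x ∧ Monotone γ ∧ IsGradientCurve U γ :=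
  exists_monotone_isIntegralCurve_of_periodic hper one_ne_zero hU x

namespace IsGradientCurve

theorem comp_neg (hγ : IsGradientCurve U γ) : IsGradientCurve U fun t => γ (-t) :=
  hγ.symm.imp (fun h => by simpa using isIntegralCurve_comp_neg h) isIntegralCurve_comp_neg

theorem exists_vectorField (hγ : IsGradientCurve U γ) (hper : Function.Periodic (deriv U) 1)
    (hU : ContDiff ℝ 1 (deriv U)) :
    ∃ (v : ℝ → ℝ) (K : NNReal), (IsIntegralCurve γ fun _ => v) ∧ ContDiff ℝ 1 v ∧
      LipschitzWith K v ∧ ∀ x, v x = 0 ↔ deriv U x = 0 := by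
  obtain ⟨K, hK⟩ := exists_lipschitzWith_of_periodic hper one_ne_zero hU
  rcases hγ with hγ | hγ
  · exact ⟨_, K, hγ, hU, hK, fun x => Iff.rfl⟩
  · exact ⟨_, K, hγ, hU.neg, hK.neg, fun x => neg_eq_zero⟩

theorem contDiff_one (hγ : IsGradientCurve U γ) (hU : ContDiff ℝ 1 (deriv U)) :
    ContDiff ℝ 1 γ :=
  (hγ.elim (contDiff_two_of_isIntegralCurve hU)
    (contDiff_two_of_isIntegralCurve hU.neg)).of_le one_le_two

theorem deriv_eq (hγ : IsGradientCurve U γ) (t : ℝ) :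
    deriv γ t = deriv U (γ t) ∨ deriv γ t = -deriv U (γ t) :=
  hγ.imp (fun h => (h t).deriv) fun h => (h t).deriv

theorem deriv_ne_zero_of_mem_Ioc (hγ : IsGradientCurve U γ)
    (hper : Function.Periodic (deriv U) 1) (hU : ContDiff ℝ 1 (deriv U)) {c s t : ℝ}
    (hc : c ∈ Ioc (γ s) (γ t)) : deriv U c ≠ 0 := by
  obtain ⟨v, K, hv, -, hK, hzero⟩ := hγ.exists_vectorField hper hU
  exact fun h => hc.1.not_ge (equilibrium_le_of_isIntegralCurve hK hv ((hzero c).2 h) hc.2 s)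

theorem deriv_ne_zero_of_mem_Ico (hγ : IsGradientCurve U γ)
    (hper : Function.Periodic (deriv U) 1) (hU : ContDiff ℝ 1 (deriv U)) {c s t : ℝ}
    (hc : c ∈ Ico (γ s) (γ t)) : deriv U c ≠ 0 := by
  obtain ⟨v, K, hv, -, hK, hzero⟩ := hγ.exists_vectorField hper hU
  exact fun h => hc.2.not_ge (le_equilibrium_of_isIntegralCurve hK hv ((hzero c).2 h) hc.1 t)

theorem exists_tendsto_atBot (hγ : IsGradientCurve U γ) (hper : Function.Periodic (deriv U) 1)
    (hU : ContDiff ℝ 1 (deriv U)) (hcrit : ∃ c, deriv U c = 0) :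
    ∃ c, deriv U c = 0 ∧ Tendsto γ atBot (𝓝 c) := by
  obtain ⟨v, K, hv, hv1, hK, hzero⟩ := hγ.exists_vectorField hper hU
  obtain ⟨c, hc⟩ := hcrit
  obtain ⟨l, hl, hcl⟩ := hper.exists_mem_Ioc one_pos c (γ 0 - 1)
  obtain ⟨r, hr, hcr⟩ := hper.exists_mem_Ioc one_pos c (γ 0)
  have hlow := equilibrium_le_of_isIntegralCurve hK hv ((hzero l).2 (hcl.symm.trans hc))
    (show l ≤ γ 0 by linarith [hl.2])
  have hupp := le_equilibrium_of_isIntegralCurve hK hv ((hzero r).2 (hcr.symm.trans hc)) hr.1.le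
  obtain ⟨d, hd⟩ : ∃ d, Tendsto γ atBot (𝓝 d) := by
    rcases monotone_or_antitone_of_isIntegralCurve hK hv with hmono | hanti
    · exact ⟨_, tendsto_atBot_ciInf hmono ⟨l, forall_mem_range.2 hlow⟩⟩
    · exact ⟨_, tendsto_atBot_ciSup hanti ⟨r, forall_mem_range.2 hupp⟩⟩
  exact ⟨d, (hzero d).1 (eq_zero_of_isIntegralCurve_of_tendsto_atBot hv1.continuous hv hd), hd⟩

end IsGradientCurve

theorem lagrangian_eq_max_mul {s x : ℝ} (h : s = deriv U x ∨ s = -deriv U x) (hs : 0 ≤ s) :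
    lagrangian U s x = max (deriv U x) 0 * s := by
  rcases h with rfl | rfl
  · rw [max_eq_left hs, lagrangian]
    ring
  · rw [max_eq_right (neg_nonneg.1 hs), lagrangian]
    ring

theorem lagrangian_eq_min_mul {s x : ℝ} (h : s = deriv U x ∨ s = -deriv U x) (hs : s ≤ 0) :
    lagrangian U s x = min (deriv U x) 0 * s := by
  rcases h with rfl | rfl
  · rw [min_eq_left hs, lagrangian]
    ring
  · rw [min_eq_right (neg_nonpos.1 hs), lagrangian]
    ring

theorem piecewiseC1On_of_contDiff (hγ : ContDiff ℝ 1 γ) {a b : ℝ} (hab : a ≤ b) :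
    PiecewiseC1On γ a b := by
  refine ⟨hγ.continuous.continuousOn, 1, fun n => if n = 0 then a else b,
    monotone_nat_of_le_succ fun n => ?_, by simp, by simp, fun i _ => hγ.contDiffOn⟩
  by_cases h : n = 0 <;> simp [h, hab]

namespace IsCriticalEnvelope

variable {u : UnitAddCircle → ℝ≥0∞} {Ψ : ℝ → ℝ}

theorem isCalibratedCurve (hu : IsCriticalEnvelope U u) (hper : Function.Periodic (deriv U) 1)
    (hU : Continuous (deriv U)) (hfin : ∀ x, u x ≠ ⊤) (hΨ : IsCriticalSubsolution U Ψ)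
    (hγ : ContDiff ℝ 1 γ)
    (hL : ∀ t, lagrangian U (deriv γ t) (γ t) = deriv Ψ (γ t) * deriv γ t)
    (hle : ∀ t ≤ 0, u (γ t) + ENNReal.ofReal (Ψ (γ 0) - Ψ (γ t)) ≤ u (γ 0)) :
    IsCalibratedCurve U (fun x => (u x).toReal) γ := by
  refine ⟨fun a ha => piecewiseC1On_of_contDiff hγ ha, fun a b hab hb => ?_⟩
  have hint := hΨ.integral_lagrangian_eq_sub hγ hL
  have hmono {s t : ℝ} (hst : s ≤ t) : 0 ≤ Ψ (γ t) - Ψ (γ s) := by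
    rw [← hint]
    exact intervalIntegral.integral_nonneg hst fun r _ => lagrangian_nonneg _ _ _
  have hupper {s t : ℝ} (hst : s ≤ t) :
      (u (γ t)).toReal ≤ (u (γ s)).toReal + (Ψ (γ t) - Ψ (γ s)) := by
    have h := hu.le_add_action hper hst hγ.contDiffOn.absolutelyContinuousOnInterval
    rw [action_eq_ofReal_integral hU hγ hst, hint] at h
    simpa [hmono hst] using ENNReal.toReal_le_add h (hfin _) ENNReal.ofReal_ne_top
  have hlower : (u (γ a)).toReal + (Ψ (γ 0) - Ψ (γ a)) ≤ (u (γ 0)).toReal := by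
    have h := ENNReal.toReal_mono (hfin _) (hle a (hab.le.trans hb))
    rwa [ENNReal.toReal_add (hfin _) ENNReal.ofReal_ne_top,
      ENNReal.toReal_ofReal (hmono (hab.le.trans hb))] at h
  rw [hint]
  linarith [hupper hab.le, hupper hb]

theorem add_ofReal_le_of_mem_uIcc (hu : IsCriticalEnvelope U u)
    (hper : Function.Periodic (deriv U) 1) (hΨ : IsCriticalSubsolution U Ψ) {T : ℝ} (hT : 0 ≤ T)
    (hγ : AbsolutelyContinuousOnInterval γ 0 T) {y : ℝ} (hy : y ∈ uIcc (γ 0) (γ T)) :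
    u y + ENNReal.ofReal (Ψ (γ T) - Ψ y) ≤ u (γ 0) + action U γ 0 T := by
  obtain ⟨τ, hτ, rfl⟩ := intermediate_value_uIcc hγ.continuousOn hy
  have hτ' := uIcc_of_le hT ▸ hτ
  rw [← action_add U γ hτ'.1 hτ'.2, ← add_assoc]
  exact add_le_add (hu.le_add_action hper hτ'.1 (hγ.mono (uIcc_subset_uIcc_left hτ)))
    (hΨ.ofReal_sub_le_action hτ'.2 (hγ.mono (uIcc_subset_uIcc_right hτ)))

/- If both alternatives failed, at `y` and at `z`, then a nearly optimal curve from a critical point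
to `x` would enter `[y, z]` through `y` or through `z`, and would be too expensive either way. -/
theorem left_or_right (hu : IsCriticalEnvelope U u) (hper : Function.Periodic (deriv U) 1)
    (hU : Continuous (deriv U)) (x : ℝ) :
    (∀ y ≤ x, (∀ c ∈ Ioc y x, deriv U c ≠ 0) →
      u y + ENNReal.ofReal (rightPotential U x - rightPotential U y) ≤ u x) ∨
    ∀ z ≥ x, (∀ c ∈ Ico x z, deriv U c ≠ 0) →
      u z + ENNReal.ofReal (leftPotential U x - leftPotential U z) ≤ u x := by
  by_contra! ⟨⟨y, hyx, hy, hlty⟩, z, hxz, hz, hltz⟩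
  obtain ⟨T, γ, hT, hγ, hcrit, rfl, hlt⟩ := hu.exists_curve_of_lt hper (lt_min hlty hltz)
  rcases le_or_gt (γ 0) (γ T) with h | h
  · have hγy : γ 0 ≤ y := not_lt.1 fun h' => hy _ ⟨h', h⟩ hcrit
    exact (hlt.trans_le (min_le_left _ _)).not_ge (hu.add_ofReal_le_of_mem_uIcc hper
      (isCriticalSubsolution_rightPotential hper hU) hT hγ (mem_uIcc_of_le hγy hyx))
  · have hzγ : z ≤ γ 0 := not_lt.1 fun h' => hz _ ⟨h.le, h'⟩ hcrit
    exact (hlt.trans_le (min_le_right _ _)).not_ge (hu.add_ofReal_le_of_mem_uIcc hper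
      (isCriticalSubsolution_leftPotential hper hU) hT hγ (mem_uIcc_of_ge hxz hzγ))

theorem exists_isCalibratedCurve (hu : IsCriticalEnvelope U u)
    (hper : Function.Periodic (deriv U) 1) (hU : ContDiff ℝ 1 (deriv U)) (hfin : ∀ x, u x ≠ ⊤)
    (x : ℝ) :
    ∃ γ : ℝ → ℝ, γ 0 = x ∧ IsCalibratedCurve U (fun x => (u x).toReal) γ ∧
      IsGradientCurve U γ := by
  obtain ⟨γ, hγx, hmono, hγ⟩ := exists_monotone_isGradientCurve hper hU x
  have hc := hU.continuous
  rcases hu.left_or_right hper hc x with hleft | hright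
  · refine ⟨γ, hγx, hu.isCalibratedCurve hper hc hfin
      (isCriticalSubsolution_rightPotential hper hc) (hγ.contDiff_one hU) (fun t => ?_)
      fun t ht => ?_, hγ⟩
    · rw [deriv_rightPotential hc, lagrangian_eq_max_mul (hγ.deriv_eq t) hmono.deriv_nonneg]
    · subst hγx
      exact hleft _ (hmono ht) fun c hc => hγ.deriv_ne_zero_of_mem_Ioc hper hU hc
  · have hanti : Antitone fun t => γ (-t) := fun s t h => hmono (neg_le_neg h)
    refine ⟨fun t => γ (-t), by simpa using hγx, hu.isCalibratedCurve hper hc hfin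
      (isCriticalSubsolution_leftPotential hper hc) (hγ.comp_neg.contDiff_one hU) (fun t => ?_)
      fun t ht => ?_, hγ.comp_neg⟩
    · rw [deriv_leftPotential hc, lagrangian_eq_min_mul (hγ.comp_neg.deriv_eq t)
        hanti.deriv_nonpos]
    · subst hγx
      rw [neg_zero]
      exact hright _ (hmono (neg_nonneg.2 ht)) fun c hc => hγ.deriv_ne_zero_of_mem_Ico hper hU hc

end IsCriticalEnvelope

namespace IsCriticalSubsolution

theorem ofReal_mul_le_action_of_eq_add_intCast {Ψ : ℝ → ℝ} (hΨ : IsCriticalSubsolution U Ψ)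
    {a b : ℝ} {n : ℤ} (hab : a ≤ b) (hγ : AbsolutelyContinuousOnInterval γ a b)
    (hn : γ b = γ a + n) : ENNReal.ofReal (n * (Ψ 1 - Ψ 0)) ≤ action U γ a b := by
  have h := hΨ.ofReal_sub_le_action hab hγ
  rwa [hn, sub_add_intCast_eq_mul_of_periodic_deriv hΨ.contDiff hΨ.periodic_deriv] at h

end IsCriticalSubsolution

theorem rightPotential_zero_lt_one (hper : Function.Periodic (deriv U) 1)
    (hU : Continuous (deriv U)) (hpos : ∃ x, 0 < deriv U x) :
    rightPotential U 0 < rightPotential U 1 := by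
  have h := intervalIntegral_pos_of_periodic (hper.comp (max · 0)) one_pos
    (hU.max continuous_const) (fun _ => le_max_right _ _)
    (hpos.imp fun _ => lt_max_of_lt_left) 0
  simpa [rightPotential] using h

theorem leftPotential_one_lt_zero (hper : Function.Periodic (deriv U) 1)
    (hU : Continuous (deriv U)) (hneg : ∃ x, deriv U x < 0) :
    leftPotential U 1 < leftPotential U 0 := by
  have h := intervalIntegral_pos_of_periodic (hper.comp (- min · 0)) one_pos
    (hU.min continuous_const).neg (fun _ => neg_nonneg.2 (min_le_right _ _))
    (hneg.imp fun _ h => neg_pos.2 (min_lt_of_left_lt h)) 0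
  simpa [leftPotential] using h

theorem exists_pos_le_action_of_winding (hper : Function.Periodic (deriv U) 1)
    (hU : Continuous (deriv U)) (hpos : ∃ x, 0 < deriv U x) (hneg : ∃ x, deriv U x < 0) :
    ∃ δ > 0, ∀ (γ : ℝ → ℝ) (a b : ℝ) (n : ℤ), a ≤ b → AbsolutelyContinuousOnInterval γ a b →
      n ≠ 0 → γ b = γ a + n → ENNReal.ofReal δ ≤ action U γ a b := by
  have hR := sub_pos.2 (rightPotential_zero_lt_one hper hU hpos)
  have hL := sub_pos.2 (leftPotential_one_lt_zero hper hU hneg)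
  refine ⟨_, lt_min hR hL, fun γ a b n hab hγ hn0 hn => ?_⟩
  rcases lt_or_gt_of_ne hn0 with hlt | hgt
  · have hn1 : (n : ℝ) ≤ -1 := mod_cast Int.le_sub_one_of_lt hlt
    refine le_trans (ENNReal.ofReal_le_ofReal ((min_le_right _ _).trans ?_))
      ((isCriticalSubsolution_leftPotential hper hU).ofReal_mul_le_action_of_eq_add_intCast
        hab hγ hn)
    nlinarith
  · have hn1 : (1 : ℝ) ≤ n := mod_cast hgt
    exact le_trans (ENNReal.ofReal_le_ofReal
      ((min_le_left _ _).trans (le_mul_of_one_le_left hR.le hn1)))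
      ((isCriticalSubsolution_rightPotential hper hU).ofReal_mul_le_action_of_eq_add_intCast
        hab hγ hn)

theorem rightPotential_sub_add_leftPotential_sub (hU : Continuous (deriv U)) (x y : ℝ) :
    (rightPotential U y - rightPotential U x) + (leftPotential U x - leftPotential U y) =
      ∫ s in x..y, |deriv U s| := by
  have hmax (a b : ℝ) : IntervalIntegrable (fun s => max (deriv U s) 0) volume a b :=
    (hU.max continuous_const).intervalIntegrable a b
  have hmin (a b : ℝ) : IntervalIntegrable (fun s => min (deriv U s) 0) volume a b :=
    (hU.min continuous_const).intervalIntegrable a b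
  unfold rightPotential leftPotential
  rw [intervalIntegral.integral_interval_sub_left (hmax _ _) (hmax _ _),
    intervalIntegral.integral_interval_sub_left (hmin _ _) (hmin _ _),
    intervalIntegral.integral_symm x y, ← sub_eq_add_neg,
    ← intervalIntegral.integral_sub (hmax _ _) (hmin _ _)]
  simp only [max_sub_min_eq_abs, zero_sub, abs_neg]

/- The loop pays for one of the two potentials on its way to `γ t` and for the other one on its
way back. -/
theorem ofReal_abs_integral_le_action_of_loop (hper : Function.Periodic (deriv U) 1)
    (hU : Continuous (deriv U)) {a b t : ℝ} (hγ : AbsolutelyContinuousOnInterval γ a b)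
    (hloop : γ b = γ a) (ht : t ∈ Icc a b) :
    ENNReal.ofReal |(∫ s in γ a..γ t, |deriv U s|)| ≤ action U γ a b := by
  have hR := isCriticalSubsolution_rightPotential hper hU
  have hL := isCriticalSubsolution_leftPotential hper hU
  have ht' : t ∈ uIcc a b := Icc_subset_uIcc ht
  have hγ₁ := hγ.mono (uIcc_subset_uIcc_left ht')
  have hγ₂ := hγ.mono (uIcc_subset_uIcc_right ht')
  rw [← action_add U γ ht.1 ht.2]
  rcases abs_choice (∫ s in γ a..γ t, |deriv U s|) with h | h
  · rw [h, ← rightPotential_sub_add_leftPotential_sub hU]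
    nth_rw 2 [← hloop]
    exact ENNReal.ofReal_add_le.trans
      (add_le_add (hR.ofReal_sub_le_action ht.1 hγ₁) (hL.ofReal_sub_le_action ht.2 hγ₂))
  · rw [h, ← intervalIntegral.integral_symm, ← rightPotential_sub_add_leftPotential_sub hU,
      add_comm]
    nth_rw 2 [← hloop]
    exact ENNReal.ofReal_add_le.trans
      (add_le_add (hL.ofReal_sub_le_action ht.1 hγ₁) (hR.ofReal_sub_le_action ht.2 hγ₂))

theorem ofReal_mul_le_action_of_loop (hU : ContDiff ℝ 1 U) {a b c : ℝ} (hab : a ≤ b)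
    (hγ : AbsolutelyContinuousOnInterval γ a b) (hloop : γ b = γ a) (hc : 0 ≤ c)
    (hle : ∀ t ∈ Icc a b, c ≤ |deriv U (γ t)|) :
    ENNReal.ofReal (c ^ 2 / 4 * (b - a)) ≤ action U γ a b := by
  have h := ofReal_sub_add_mul_le_action (U := U) (Ψ := fun x => U x / 2) (e := c ^ 2 / 4)
    hab hγ (hU.div_const 2) fun t ht s => by
      have hsq : c ^ 2 ≤ deriv U (γ t) ^ 2 := sq_abs (deriv U (γ t)) ▸ by gcongr; exact hle t ht
      simp only [deriv_div_const, lagrangian]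
      nlinarith [sq_nonneg s]
  simpa [hloop] using h

theorem ofReal_min_le_action_of_loop (hper : Function.Periodic (deriv U) 1)
    (hU : ContDiff ℝ 1 U) {a b c ε : ℝ} (hab : a ≤ b)
    (hγ : AbsolutelyContinuousOnInterval γ a b) (hloop : γ b = γ a) (hc : 0 ≤ c) (hε : 0 ≤ ε)
    (hle : ∀ y ∈ Metric.closedBall (γ a) ε, c ≤ |deriv U y|) :
    ENNReal.ofReal (min (c * ε) (c ^ 2 / 4 * (b - a))) ≤ action U γ a b := by
  by_cases hstay : ∀ t ∈ Icc a b, γ t ∈ Metric.closedBall (γ a) ε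
  · exact (ENNReal.ofReal_le_ofReal (min_le_right _ _)).trans
      (ofReal_mul_le_action_of_loop hU hab hγ hloop hc fun t ht => hle _ (hstay t ht))
  · push Not at hstay
    obtain ⟨t, ht, hfar⟩ := hstay
    obtain ⟨s, hs, hdist⟩ : ε ∈ (fun s => |γ s - γ a|) '' Icc a t := by
      have hcont : ContinuousOn γ (Icc a t) :=
        hγ.continuousOn.mono ((Icc_subset_Icc_right ht.2).trans Icc_subset_uIcc)
      refine intermediate_value_Icc ht.1 (hcont.sub continuousOn_const).abs ⟨by simpa, ?_⟩
      exact (not_le.1 hfar).le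
    have hU' := hU.continuous_deriv le_rfl
    refine (ENNReal.ofReal_le_ofReal ((min_le_left _ _).trans ?_)).trans
      (ofReal_abs_integral_le_action_of_loop hper hU' hγ hloop (Icc_subset_Icc_right ht.2 hs))
    rw [← hdist]
    refine mul_abs_sub_le_abs_integral hU'.abs fun y hy => hle y ?_
    rw [← hdist]
    exact abs_sub_left_of_mem_uIcc hy

theorem le_peierlsBarrier_self (hper : Function.Periodic (deriv U) 1) {x : ℝ} {δ : ℝ≥0∞}
    (hδ : ∀ (γ : ℝ → ℝ) (T : ℝ) (n : ℤ), 1 ≤ T → AbsolutelyContinuousOnInterval γ 0 T →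
      γ 0 = x → γ T = x + n → δ ≤ action U γ 0 T) : δ ≤ peierlsBarrier U x x := by
  refine le_liminf_of_le (by isBoundedDefault) ?_
  filter_upwards [eventually_ge_atTop 1] with T hT
  refine le_iInf₂ fun γ hγ => le_iInf₂ fun h₀ h₁ => ?_
  obtain ⟨l, hl⟩ := exists_eq_add_intCast_of_coe_eq h₀
  obtain ⟨n, hn⟩ := exists_eq_add_intCast_of_coe_eq h₁
  rw [← action_add_intCast hper (-l)]
  refine hδ _ T (n - l) hT (hγ.add (absolutelyContinuousOnInterval_const _ 0 T)) ?_ ?_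
  · rw [hl]; push_cast; ring
  · rw [hn]; push_cast; ring

theorem peierlsBarrier_self_pos (hper : Function.Periodic (deriv U) 1)
    (hU : ContDiff ℝ 1 U) (hpos : ∃ x, 0 < deriv U x) (hneg : ∃ x, deriv U x < 0) {x : ℝ}
    (hx : deriv U x ≠ 0) : 0 < peierlsBarrier U x x := by
  have hU' := hU.continuous_deriv le_rfl
  obtain ⟨δ, hδ, hwind⟩ := exists_pos_le_action_of_winding hper hU' hpos hneg
  obtain ⟨c, hc, hcx⟩ := exists_between (abs_pos.2 hx)
  obtain ⟨ε, hε, hball⟩ := Metric.nhds_basis_closedBall.eventually_iff.1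
    (hU'.abs.continuousAt.eventually_const_le hcx)
  suffices ENNReal.ofReal (min δ (min (c * ε) (c ^ 2 / 4))) ≤ peierlsBarrier U x x from
    (ENNReal.ofReal_pos.2 (by positivity)).trans_le this
  refine le_peierlsBarrier_self hper fun γ T n hT hγ h₀ h₁ => ?_
  have hT0 : 0 ≤ T := zero_le_one.trans hT
  by_cases hn : n = 0
  · have hloop : γ T = γ 0 := by simp [h₀, h₁, hn]
    refine le_trans (ENNReal.ofReal_le_ofReal ?_) (ofReal_min_le_action_of_loop hper hU hT0 hγ
      hloop hc.le hε.le fun y hy => hball (h₀ ▸ hy))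
    rw [sub_zero]
    exact (min_le_right _ _).trans
      (min_le_min_left _ (le_mul_of_one_le_right (by positivity) hT))
  · exact (ENNReal.ofReal_le_ofReal (min_le_left _ _)).trans
      (hwind γ 0 T n hT0 hγ hn (by rw [h₁, h₀]))

theorem projectedAubrySet_eq_criticalSet (hper : Function.Periodic (deriv U) 1)
    (hU : ContDiff ℝ 1 U) (hpos : ∃ x, 0 < deriv U x) (hneg : ∃ x, deriv U x < 0) :
    projectedAubrySet U = criticalSet U := by
  refine Subset.antisymm (fun p hp => ?_) fun p hp =>
    (peierlsBarrier_eq_manePotential hper hp).trans (manePotential_self_eq_zero hp)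
  obtain ⟨x, rfl⟩ := QuotientAddGroup.mk_surjective p
  by_contra hx
  exact (peierlsBarrier_self_pos hper hU hpos hneg
    fun h => hx ((coe_mem_criticalSet_iff hper).2 h)).ne' hp

theorem deriv_lagrangian_fst (U : ℝ → ℝ) (s x : ℝ) :
    deriv (fun s => lagrangian U s x) s = (s + deriv U x) / 2 := by
  have h := (((hasDerivAt_id' s).add_const (deriv U x)).fun_pow 2).div_const 4
  refine h.deriv.trans ?_
  push_cast
  ring

theorem deriv_lagrangian_snd (hU : Differentiable ℝ (deriv U)) (s x : ℝ) :
    deriv (fun x => lagrangian U s x) x = deriv (deriv U) x * (s + deriv U x) / 2 := by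
  have h := (((hU x).hasDerivAt.const_add s).fun_pow 2).div_const 4
  refine h.deriv.trans ?_
  push_cast
  ring

theorem isEulerLagrangeCurve_of_isIntegralCurve (hU : ContDiff ℝ 1 (deriv U))
    (hγ : IsIntegralCurve γ fun _ => -deriv U) : IsEulerLagrangeCurve U γ := by
  refine ⟨contDiff_two_of_isIntegralCurve hU.neg hγ, fun t => ?_⟩
  have hγ' (t : ℝ) : deriv γ t = -deriv U (γ t) := (hγ t).deriv
  simp only [deriv_lagrangian_fst, deriv_lagrangian_snd (hU.differentiable one_ne_zero), hγ',
    neg_add_cancel, zero_div, deriv_const, mul_zero]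

/- The momentum `(γ' + U'(γ)) / 2` solves a linear equation along an Euler-Lagrange curve. -/
theorem IsEulerLagrangeCurve.isIntegralCurve (hγ : IsEulerLagrangeCurve U γ)
    (hU : ContDiff ℝ 1 (deriv U)) {t₀ : ℝ} (h₀ : deriv γ t₀ = -deriv U (γ t₀)) :
    IsIntegralCurve γ fun _ => -deriv U := by
  obtain ⟨hγ2, hEL⟩ := hγ
  have hUd : Differentiable ℝ (deriv U) := hU.differentiable one_ne_zero
  have hγd : Differentiable ℝ γ := hγ2.differentiable two_ne_zero
  have hmomentum (t : ℝ) : HasDerivAt (fun t => (deriv γ t + deriv U (γ t)) / 2)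
      (deriv (deriv U) (γ t) * ((deriv γ t + deriv U (γ t)) / 2)) t := by
    have hγd' : Differentiable ℝ (deriv γ) := hγ2.differentiable_deriv_two
    have h := hEL t
    simp only [deriv_lagrangian_fst, deriv_lagrangian_snd hUd] at h
    rw [← mul_div_assoc, ← h]
    exact ((hγd'.add (hUd.comp hγd)).div_const 2 t).hasDerivAt
  intro t
  have hzero := eq_zero_of_hasDerivAt_mul ((hU.continuous_deriv le_rfl).comp hγd.continuous)
    hmomentum (t₀ := t₀) (by simp [h₀]) t
  have hderiv : deriv γ t = -deriv U (γ t) := by linarith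
  simpa [hderiv] using (hγd t).hasDerivAt

theorem tangentLift_mem_flowPreimage_iff (hper : Function.Periodic (deriv U) 1)
    (hU : ContDiff ℝ 1 (deriv U)) (hγ : IsIntegralCurve γ fun _ => -deriv U) {s t : ℝ}
    {B : Set (ℝ × UnitAddCircle)} :
    tangentLift γ s ∈ flowPreimage U t B ↔ tangentLift γ (t + s) ∈ B := by
  have hshift : IsIntegralCurve (fun r => γ (r + s)) fun _ => -deriv U := hγ.comp_add s
  have hlift (r : ℝ) : tangentLift (fun r => γ (r + s)) r = tangentLift γ (r + s) := by
    simp only [tangentLift, deriv_comp_add_const]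
  refine ⟨?_, fun h => ⟨_, isEulerLagrangeCurve_of_isIntegralCurve hU hshift,
    by rw [hlift, zero_add], by rwa [hlift]⟩⟩
  rintro ⟨η, hη, h₀, ht⟩
  obtain ⟨hη₀', hη₀⟩ := Prod.ext_iff.1 h₀
  simp only [tangentLift] at hη₀ hη₀'
  obtain ⟨n, hn⟩ := exists_eq_add_intCast_of_coe_eq hη₀
  have hforce (x : ℝ) : deriv U (x + n) = deriv U x := by simpa using hper.int_mul n x
  have hηint := hη.isIntegralCurve hU (t₀ := 0) (by rw [hη₀', (hγ s).deriv, hn, hforce]; rfl)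
  have hshift' : IsIntegralCurve (fun r => γ (r + s) + n) fun _ => -deriv U := fun r => by
    simpa [hforce] using (hshift r).add_const (n : ℝ)
  obtain ⟨K, hK⟩ := exists_lipschitzWith_of_periodic hper one_ne_zero hU
  rw [isIntegralCurve_unique_of_lipschitzWith hK.neg hηint hshift' (t₀ := 0)
    (by simpa using hn)] at ht
  simpa [tangentLift, deriv_comp_add_const] using ht

theorem isInvariantProb_dirac (hper : Function.Periodic (deriv U) 1)
    (hU : ContDiff ℝ 1 (deriv U)) {c : ℝ} (hc : deriv U c = 0) :
    IsInvariantProb U (Measure.dirac (0, (c : UnitAddCircle))) := by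
  refine ⟨inferInstance, fun t B _ => ?_⟩
  have hconst : IsIntegralCurve (fun _ => c) fun _ => -deriv U :=
    isIntegralCurve_const fun _ => by simpa using hc
  have hmem := tangentLift_mem_flowPreimage_iff hper hU hconst (s := 0) (t := t) (B := B)
  simp only [tangentLift, deriv_const] at hmem
  rw [Measure.dirac_apply, Measure.dirac_apply]
  by_cases hB : (0, (c : UnitAddCircle)) ∈ B <;> simp [hmem, hB]

theorem deriv_equivIco (hper : Function.Periodic (deriv U) 1) (x : ℝ) :
    deriv U (AddCircle.equivIco (1 : ℝ) 0 (x : UnitAddCircle) : ℝ) = deriv U x := by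
  obtain ⟨n, hn⟩ := exists_eq_add_intCast_of_coe_eq
    (AddCircle.coe_equivIco :
      ((AddCircle.equivIco (1 : ℝ) 0 (x : UnitAddCircle) : ℝ) : UnitAddCircle) = x)
  rw [hn]
  simpa using hper.int_mul n x

theorem averageAction_dirac (hper : Function.Periodic (deriv U) 1) {c : ℝ}
    (hc : deriv U c = 0) : averageAction U (Measure.dirac (0, (c : UnitAddCircle))) = 0 := by
  rw [averageAction, lintegral_dirac, lagrangian, deriv_equivIco hper, hc]
  simp

theorem isMatherMeasure_dirac (hper : Function.Periodic (deriv U) 1)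
    (hU : ContDiff ℝ 1 (deriv U)) {c : ℝ} (hc : deriv U c = 0) :
    IsMatherMeasure U (Measure.dirac (0, (c : UnitAddCircle))) :=
  ⟨isInvariantProb_dirac hper hU hc, fun _ _ => averageAction_dirac hper hc ▸ bot_le⟩

theorem ae_fst_eq_neg_deriv_of_averageAction_eq_zero (hper : Function.Periodic (deriv U) 1)
    (hU : Continuous (deriv U)) {μ : Measure (ℝ × UnitAddCircle)} (hμ : averageAction U μ = 0) :
    ∀ᵐ p ∂μ, ∀ x : ℝ, (x : UnitAddCircle) = p.2 → p.1 = -deriv U x := by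
  have hmeas : Measurable fun p : ℝ × UnitAddCircle =>
      lagrangian U p.1 (AddCircle.equivIco (1 : ℝ) 0 p.2 : ℝ) := by
    have hrep : Measurable fun p : ℝ × UnitAddCircle => (AddCircle.equivIco (1 : ℝ) 0 p.2 : ℝ) :=
      measurable_subtype_coe.comp ((AddCircle.measurableEquivIco (1 : ℝ) 0).measurable.comp
        measurable_snd)
    exact ((measurable_fst.add (hU.measurable.comp hrep)).pow_const 2).div_const 4
  rw [averageAction, lintegral_eq_zero_iff hmeas.ennreal_ofReal] at hμ
  filter_upwards [hμ] with p hp x hx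
  have hL : lagrangian U p.1 x = 0 := by
    refine le_antisymm ?_ (lagrangian_nonneg U _ _)
    rw [← hx] at hp
    simpa only [lagrangian, deriv_equivIco hper] using ENNReal.ofReal_eq_zero.1 hp
  simp only [lagrangian, div_eq_zero_iff, OfNat.ofNat_ne_zero, or_false, pow_eq_zero_iff,
    ne_eq, not_false_eq_true] at hL
  exact eq_neg_of_add_eq_zero_left hL

namespace IsMatherMeasure

variable {μ : Measure (ℝ × UnitAddCircle)}

theorem ae_fst_eq_neg_deriv (hμ : IsMatherMeasure U μ) (hper : Function.Periodic (deriv U) 1)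
    (hU : ContDiff ℝ 1 (deriv U)) (hcrit : ∃ c, deriv U c = 0) :
    ∀ᵐ p ∂μ, ∀ x : ℝ, (x : UnitAddCircle) = p.2 → p.1 = -deriv U x := by
  obtain ⟨c, hc⟩ := hcrit
  refine ae_fst_eq_neg_deriv_of_averageAction_eq_zero hper hU.continuous (nonpos_iff_eq_zero.1 ?_)
  exact (hμ.2 _ (isInvariantProb_dirac hper hU hc)).trans (averageAction_dirac hper hc).le

theorem measure_tail_le (hμ : IsMatherMeasure U μ) (hper : Function.Periodic (deriv U) 1)
    (hU : ContDiff ℝ 1 (deriv U)) (hcrit : ∃ c, deriv U c = 0)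
    (hγ : IsIntegralCurve γ fun _ => -deriv U) (r s : ℝ)
    (hmeas : MeasurableSet ((fun t => (γ t : UnitAddCircle)) '' Ioi s)) :
    μ (Prod.snd ⁻¹' ((fun t => (γ t : UnitAddCircle)) '' Ioi r)) ≤
      μ (Prod.snd ⁻¹' ((fun t => (γ t : UnitAddCircle)) '' Ioi s)) := by
  rw [← hμ.1.2 (s - r) _ (measurable_snd hmeas)]
  refine measure_mono_ae ?_
  filter_upwards [hμ.ae_fst_eq_neg_deriv hper hU hcrit] with p hp
  rintro ⟨t, ht : r < t, htp⟩
  have hlift : p = tangentLift γ t :=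
    Prod.ext ((hp _ htp).trans (hγ t).deriv.symm) htp.symm
  rw [hlift]
  refine (tangentLift_mem_flowPreimage_iff hper hU hγ).2 ⟨s - r + t, ?_, rfl⟩
  exact mem_Ioi.2 (by linarith)

/- By invariance two tails of the trajectory have the same measure, so what lies between is null. -/
theorem measure_image_Ioo_eq_zero (hμ : IsMatherMeasure U μ) (hper : Function.Periodic (deriv U) 1)
    (hU : ContDiff ℝ 1 (deriv U)) (hcrit : ∃ c, deriv U c = 0)
    (hγ : IsIntegralCurve γ fun _ => -deriv U)
    (hinj : Function.Injective fun t => (γ t : UnitAddCircle))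
    (hopen : IsOpenMap fun t => (γ t : UnitAddCircle)) (r s : ℝ) :
    μ (Prod.snd ⁻¹' ((fun t => (γ t : UnitAddCircle)) '' Ioo r s)) = 0 := by
  rcases le_or_gt s r with hsr | hrs
  · simp [Ioo_eq_empty hsr.not_gt]
  have := hμ.1.1
  have hmeas (r : ℝ) : MeasurableSet ((fun t => (γ t : UnitAddCircle)) '' Ioi r) :=
    (hopen _ isOpen_Ioi).measurableSet
  have htails := ae_eq_of_subset_of_measure_ge
    (preimage_mono (f := Prod.snd) (image_mono (Ioi_subset_Ioi hrs.le)))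
    (hμ.measure_tail_le hper hU hcrit hγ r s (hmeas s))
    (measurable_snd (hmeas s)).nullMeasurableSet (measure_ne_top μ _)
  refine measure_mono_null ?_ (ae_le_set.1 htails.symm.le)
  rw [← preimage_sdiff, ← image_sdiff hinj]
  exact preimage_mono (image_mono fun t ht => ⟨ht.1, ht.2.not_gt⟩)

theorem snd_mem_criticalSet (hμ : IsMatherMeasure U μ) (hper : Function.Periodic (deriv U) 1)
    (hU : ContDiff ℝ 1 (deriv U)) (hcrit : ∃ c, deriv U c = 0) {p : ℝ × UnitAddCircle}
    (hp : p ∈ μ.support) : p.2 ∈ criticalSet U := by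
  obtain ⟨x, hx⟩ := QuotientAddGroup.mk_surjective p.2
  by_contra hnot
  have hx0 : deriv U x ≠ 0 := fun h => hnot ⟨x, h, hx⟩
  have hper' : Function.Periodic (-deriv U) 1 := fun x => congrArg Neg.neg (hper x)
  obtain ⟨K, hK⟩ := exists_lipschitzWith_of_periodic hper' one_ne_zero hU.neg
  obtain ⟨γ, rfl, hγ⟩ := exists_isIntegralCurve_of_periodic hper' one_ne_zero hU.neg x
  have hne := ne_zero_of_isIntegralCurve hK hγ (neg_ne_zero.2 hx0)
  have hinj := injective_coe_of_isIntegralCurve hper' hK hγ hne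
    (hcrit.imp fun _ => neg_eq_zero.2)
  have hopen : IsOpenMap fun t => (γ t : UnitAddCircle) :=
    QuotientAddGroup.isOpenMap_coe.comp (isOpenMap_of_isIntegralCurve hU.neg hγ hne)
  have hnhds : Prod.snd ⁻¹' ((fun t => (γ t : UnitAddCircle)) '' Ioo (-1) 1) ∈ 𝓝 p := by
    refine (continuous_snd.isOpen_preimage _ (hopen _ isOpen_Ioo)).mem_nhds ⟨0, ?_, hx⟩
    norm_num
  exact ((Measure.mem_support_iff_forall _).1 hp _ hnhds).ne'
    (hμ.measure_image_Ioo_eq_zero hper hU hcrit hγ hinj hopen (-1) 1)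

end IsMatherMeasure

theorem isClosed_criticalSet (hper : Function.Periodic (deriv U) 1)
    (hU : Continuous (deriv U)) : IsClosed (criticalSet U) := by
  rw [← (QuotientAddGroup.isQuotientMap_mk
    (N := AddSubgroup.zmultiples (1 : ℝ))).isClosed_preimage]
  convert isClosed_eq hU continuous_const using 1
  exact ext fun x => coe_mem_criticalSet_iff hper

theorem projectedMatherSet_eq_criticalSet (hper : Function.Periodic (deriv U) 1)
    (hU : ContDiff ℝ 1 (deriv U)) (hcrit : ∃ c, deriv U c = 0) :
    projectedMatherSet U = criticalSet U := by
  refine Subset.antisymm (image_subset_iff.2 (closure_minimal ?_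
    ((isClosed_criticalSet hper hU.continuous).preimage continuous_snd))) ?_
  · rintro p ⟨μ, hμ, hp⟩
    exact hμ.snd_mem_criticalSet hper hU hcrit hp
  · rintro _ ⟨c, hc, rfl⟩
    refine ⟨(0, (c : UnitAddCircle)),
      subset_closure ⟨_, isMatherMeasure_dirac hper hU hc, ?_⟩, rfl⟩
    refine (Measure.mem_support_iff_forall _).2 fun V hV => ?_
    rw [Measure.dirac_apply_of_mem (mem_of_mem_nhds hV)]
    exact one_pos

theorem exists_deriv_pos_of_isLocalMin (hU : Differentiable ℝ U)
    (hdense : Dense {x | deriv U x = 0}ᶜ) {c : ℝ} (hc : IsLocalMin U c) : ∃ x, 0 < deriv U x := by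
  by_contra! h
  have hanti := antitone_of_deriv_nonpos hU h
  obtain ⟨d, hcd, hd⟩ := mem_nhdsGE_iff_exists_Ico_subset.1 (mem_nhdsWithin_of_mem_nhds hc)
  have hconst : ∀ y ∈ Ioo c d, U y = U c := fun y hy =>
    (hanti hy.1.le).antisymm (hd (Ioo_subset_Ico_self hy))
  obtain ⟨y, hy, hy0⟩ := hdense.exists_mem_open isOpen_Ioo (nonempty_Ioo.2 hcd)
  have hloc : U =ᶠ[𝓝 y] fun _ => U c := mem_of_superset (isOpen_Ioo.mem_nhds hy0) hconst
  exact hy (by simp [hloc.deriv_eq])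

theorem exists_deriv_neg_of_isLocalMax (hU : Differentiable ℝ U)
    (hdense : Dense {x | deriv U x = 0}ᶜ) {c : ℝ} (hc : IsLocalMax U c) : ∃ x, deriv U x < 0 := by
  have hneg : deriv (-U) = -deriv U := funext fun _ => deriv.neg
  obtain ⟨x, hx⟩ := exists_deriv_pos_of_isLocalMin hU.neg (by simpa [hneg] using hdense) hc.neg
  exact ⟨x, by simpa [hneg] using hx⟩

theorem periodic_deriv_of_skew {b : ℝ} (hskew : ∀ x, U (x + 1) = U x - b) :
    Function.Periodic (deriv U) 1 := fun x => by
  rw [← deriv_comp_add_const, funext hskew, deriv_sub_const]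

theorem periodic_coe_of_add_period {m : ℤ → ℝ} {k : ℤ} (hm : ∀ i, m (i + k) = m i + 1) :
    Function.Periodic (fun i => (m i : UnitAddCircle)) k := fun i => by
  simp only [hm, AddCircle.coe_add_period]

theorem criticalSet_eq_of_add_period {k : ℕ} {m M : ℤ → ℝ} (hm : ∀ i : ℤ, m (i + k) = m i + 1)
    (hM : ∀ i : ℤ, M (i + k) = M i + 1)
    (hcrit : ∀ x : ℝ, deriv U x = 0 ↔ (∃ i : ℤ, x = m i) ∨ ∃ i : ℤ, x = M i) :
    criticalSet U = {p : UnitAddCircle | ∃ i ∈ Finset.Icc (1 : ℤ) k,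
      p = (m i : UnitAddCircle) ∨ p = (M i : UnitAddCircle)} := by
  have hk : (0 : ℤ) < k := by
    refine Nat.cast_pos.2 (Nat.pos_of_ne_zero ?_)
    rintro rfl
    simpa using hm 0
  have hIcc {i : ℤ} (hi : i ∈ Ioc (0 : ℤ) (0 + k)) : i ∈ Finset.Icc (1 : ℤ) k := by
    simpa [Int.lt_iff_add_one_le] using hi
  refine Subset.antisymm ?_ ?_
  · rintro _ ⟨x, hx, rfl⟩
    rcases (hcrit x).1 hx with ⟨i, rfl⟩ | ⟨i, rfl⟩
    · obtain ⟨j, hj, hij⟩ := (periodic_coe_of_add_period hm).exists_mem_Ioc hk i 0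
      exact ⟨j, hIcc hj, .inl hij⟩
    · obtain ⟨j, hj, hij⟩ := (periodic_coe_of_add_period hM).exists_mem_Ioc hk i 0
      exact ⟨j, hIcc hj, .inr hij⟩
  · rintro _ ⟨i, -, rfl | rfl⟩
    · exact ⟨m i, (hcrit _).2 (.inl ⟨i, rfl⟩), rfl⟩
    · exact ⟨M i, (hcrit _).2 (.inr ⟨i, rfl⟩), rfl⟩

theorem exists_isCalibratedCurve_landscape (hper : Function.Periodic (deriv U) 1)
    (hU : ContDiff ℝ 1 (deriv U)) {k : ℕ} (hk : 1 ≤ k) {m : ℤ → ℝ} (hm : ∀ i, deriv U (m i) = 0)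
    (x : ℝ) : ∃ γ, γ 0 = x ∧ IsCalibratedCurve U (landscape U k m) γ ∧ IsGradientCurve U γ := by
  have hu := isCriticalEnvelope_iInf hper
    (fun j : Finset.Icc (1 : ℤ) k => boundaryValue U k m j)
    (c := fun j => (m j : UnitAddCircle)) fun j => ⟨m j, hm j, rfl⟩
  simp only [iInf_subtype] at hu
  have hfin : ⨅ j ∈ Finset.Icc (1 : ℤ) k,
      (boundaryValue U k m j + peierlsBarrier U (m 1) (m j)) ≠ ⊤ := by
    refine ne_top_of_le_ne_top (boundaryValue_ne_top hU.continuous hk m 1)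
      (iInf₂_le_of_le 1 (Finset.mem_Icc.2 ⟨le_rfl, mod_cast hk⟩) ?_)
    have hm1 : (m 1 : UnitAddCircle) ∈ criticalSet U := ⟨m 1, hm 1, rfl⟩
    rw [peierlsBarrier_eq_manePotential hper hm1, manePotential_self_eq_zero hm1, add_zero]
  exact hu.exists_isCalibratedCurve hper hU (hu.ne_top hper hU.continuous hfin) x

theorem mainTheorem7_general (b : ℝ) {k : ℕ} {m : ℤ → ℝ} (hU : ContDiff ℝ 2 U)
    (hskew : ∀ x : ℝ, U (x + 1) = U x - b) (hk : 1 ≤ k) (hm : ∀ i, deriv U (m i) = 0)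
    (hpos : ∃ x, 0 < deriv U x) (hneg : ∃ x, deriv U x < 0) :
    (∀ x : UnitAddCircle, ∃ γ : ℝ → ℝ,
      (γ 0 : UnitAddCircle) = x ∧
      IsCalibratedCurve U (landscape U k m) γ ∧
      ((∀ t ≤ 0, HasDerivWithinAt γ (deriv U (γ t)) (Iic 0) t) ∨
        (∀ t ≤ 0, HasDerivWithinAt γ (-deriv U (γ t)) (Iic 0) t)) ∧
      ∃ c : ℝ, deriv U c = 0 ∧ Tendsto γ atBot (𝓝 c)) ∧
    projectedMatherSet U = projectedAubrySet U ∧ projectedAubrySet U = criticalSet U := by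
  have hper := periodic_deriv_of_skew hskew
  have hU' : ContDiff ℝ 1 (deriv U) := hU.deriv'
  have hAubry := projectedAubrySet_eq_criticalSet hper (hU.of_le one_le_two) hpos hneg
  have hMather := projectedMatherSet_eq_criticalSet hper hU' ⟨m 1, hm 1⟩
  refine ⟨fun x => ?_, hMather.trans hAubry.symm, hAubry⟩
  obtain ⟨x, rfl⟩ := QuotientAddGroup.mk_surjective x
  obtain ⟨γ, rfl, hcal, hγ⟩ := exists_isCalibratedCurve_landscape hper hU' hk hm x
  exact ⟨γ, rfl, hcal, hγ.imp (fun h t _ => (h t).hasDerivWithinAt)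
    fun h t _ => (h t).hasDerivWithinAt, hγ.exists_tendsto_atBot hper hU' ⟨m 1, hm 1⟩⟩

end

theorem mainTheorem7 (U : ℝ → ℝ) (b : ℝ) (k : ℕ) (m M : ℤ → ℝ)
    (hU : ContDiff ℝ ∞ U)
    (hskew : ∀ x : ℝ, U (x + 1) = U x - b)
    (hk : 1 ≤ k)
    (hm : ∀ i : ℤ, m (i + k) = m i + 1)
    (hM : ∀ i : ℤ, M (i + k) = M i + 1)
    (hinter : ∀ i : ℤ, M (i - 1) < m i ∧ m i < M i)
    (hmin : ∀ i : ℤ, IsLocalMin U (m i))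
    (hmax : ∀ i : ℤ, IsLocalMax U (M i))
    (hcrit : ∀ x : ℝ, deriv U x = 0 ↔ (∃ i : ℤ, x = m i) ∨ ∃ i : ℤ, x = M i) :
    (∀ x : UnitAddCircle, ∃ γ : ℝ → ℝ,
      (γ 0 : UnitAddCircle) = x ∧
      IsCalibratedCurve U (landscape U k m) γ ∧
      ((∀ t ≤ 0, HasDerivWithinAt γ (deriv U (γ t)) (Set.Iic 0) t) ∨
        (∀ t ≤ 0, HasDerivWithinAt γ (-deriv U (γ t)) (Set.Iic 0) t)) ∧
      ∃ c : ℝ, deriv U c = 0 ∧ Tendsto γ atBot (𝓝 c)) ∧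
    projectedMatherSet U = projectedAubrySet U ∧
    projectedAubrySet U =
      {p : UnitAddCircle | ∃ i ∈ Finset.Icc (1 : ℤ) k,
        p = (m i : UnitAddCircle) ∨ p = (M i : UnitAddCircle)} := by
  have hdense : Dense {x | deriv U x = 0}ᶜ := by
    refine Set.Countable.dense_compl ℝ (((Set.countable_range m).union
      (Set.countable_range M)).mono fun x hx => ?_)
    exact ((hcrit x).1 hx).imp (fun ⟨i, hi⟩ => ⟨i, hi.symm⟩) fun ⟨i, hi⟩ => ⟨i, hi.symm⟩
  have hdiff : Differentiable ℝ U := hU.differentiable (by simp)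
  rw [← criticalSet_eq_of_add_period hm hM hcrit]
  exact mainTheorem7_general b (hU.of_le (by norm_cast)) hskew hk
    (fun i => (hcrit _).2 (.inl ⟨i, rfl⟩))
    (exists_deriv_pos_of_isLocalMin hdiff hdense (hmin 0))
    (exists_deriv_neg_of_isLocalMax hdiff hdense (hmax 0))
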